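/- **Setting.** A zero-one covering program is $\min w^{T}x$ subject to $Ax\ge b$, $x\in\{0,1\}^n$, where $A\in\mathbb R_{\ge 0}^{m\times n}$, $b\in\mathbb R_{\ge0}^m$, $w\in\mathbb R_{\ge0}^n$. Let $f(A)$ and $\Delta(A)$ be the maximum number of nonzero entries in a row and in a column of $A$. The communication network is the bipartite graph on variable nodes $x_1,\dots,x_n$ and constraint nodes $c_1,\dots,c_m$ with a link $\{x_j,c_i\}$ whenever $A_{i,j}\ne0$. Node $x_j$ is given $w_j$ and the $j$-th column of $A$; node $c_i$ is given $b_i$; all nodes know their identifiers, $n,m,f(A),\Delta(A)$ and $\varepsilon$, and a fixed number format in which each input number is represented by $O(\log(n+m))$ bits. Computation is deterministic and proceeds in synchronous rounds; in each round each node may send to each neighbour a message of $O(\log(n+m))$ bits (CONGEST); local computation is free. The running time is the number of rounds after which all nodes have halted; each $x_j$ then outputs its value. **The function $T$.** For a hypergraph $G=(V,E)$ (a finite set of nonempty hyperedges) with positive vertex weights $w(v)$, let $E(v)$ be the set of hyperedges containing $v$. For a real constant $\gamma>0$, natural numbers $f,D$ and $\varepsilon\in(0,1]$ put $\beta=\varepsilon/(f+\varepsilon)$,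 $q=\frac{\log D}{f\log(f/\varepsilon)\log\log D}$, and $\alpha=\max(2,q)$ if $q\ge(\log D)^{\gamma/2}$, $\alpha=2$ otherwise (for small $f,D$ with $q$ undefined, $\alpha=2$). Algorithm MWHVC, in the version in which a vertex levels up at most once per iteration, is the following. Iteration $0$: $C=\emptyset$, $\ell(v)=0$, $\mathrm{deal}(e)=\delta(e)=\frac12\min_{v\in e}w(v)/|E(v)|$. Iteration $i\ge1$: (a) every $v$ contained in an uncovered hyperedge with $\sum_{e\in E(v)}\delta(e)\ge(1-\beta)w(v)$ joins $C$; (b) let $E'(v)$ be the set of hyperedges of $E(v)$ still disjoint from $C$; every $v$ with $E'(v)\neq\emptyset$, while $\sum_{e\in E(v)}\delta(e)>w(v)(1-2^{-\ell(v)-1})$, increments $\ell(v)$ and halves $\mathrm{deal}(e)$ for all $e\in E'(v)$; (c) then every such $v$ sends "raise" to all $e\in E'(v)$ if $\sum_{e\in E'(v)}\mathrm{deal}(e)\le\frac1\alpha2^{-\ell(v)-1}w(v)$, and "stuck" otherwise; (d) every uncovered $e$ that received only "raise" multiplies $\mathrm{deal}(e)$ by $\alpha$, and for every uncovered $e$,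 $\delta(e)$ increases by $\mathrm{deal}(e)/2$. It terminates in the first iteration in which all hyperedges are covered by $C$; iteration $0$ costs two rounds and each later iteration four. Let $T_\gamma(f,D,\varepsilon)$ be the maximum number of rounds of this algorithm over all hypergraphs of rank at most $f$ and maximum degree at most $D$ and all positive vertex weights. **Claim.** For every constant $\gamma>0$ there is a deterministic distributed CONGEST algorithm that, for every $\varepsilon\in(0,1]$ and every feasible zero-one covering program, computes $x\in\{0,1\}^n$ with $Ax\ge b$ and $w^Tx\le(f(A)+\varepsilon)\cdot w^Ty$ for all $y\in\{0,1\}^n$ with $Ay\ge b$, and whose number of rounds is $$O\!\left(\Bigl(1+\frac{f(A)}{\log n}\Bigr)\cdot T_\gamma\bigl(f(A),2^{f(A)}\Delta(A),\varepsilon\bigr)\right)$$ (for $n\le 1$ the factor $1+f(A)/\log n$ is read as $1$). Moreover, with $f=f(A)$ and $D=2^{f(A)}\Delta(A)$, if $D\ge3$, the same number of rounds is $$O\!\left(\Bigl(1+\frac{f}{\log n}\Bigr)\Bigl(f\log\frac f\varepsilon+\frac{\log D}{\log\log D}+\min\bigl\{\log D,\;f\log\tfrac f\varepsilon\cdot(\log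 D)^{\gamma}\bigr\}\Bigr)\right).$$ The implied constants depend only on $\gamma$ and on the constant in the bound on the input length. -/

import Mathlib

open scoped ENNReal

noncomputable section

namespace DistCover

/-! ## Algorithm MWHVC (minimum weight hypergraph vertex cover) -/

/-- A hypergraph on the vertex set `V`: a finite set of nonempty hyperedges. -/
structure Hypergraph (V : Type) where
  edges : Finset (Finset V)
  nonempty_of_mem : ∀ e ∈ edges, e.Nonempty

section MWHVC

variable {V : Type} [Fintype V] [DecidableEq V]

/-- `E(v)`, the set of hyperedges that contain `v`. -/
def Hypergraph.incident (H : Hypergraph V) (v : V) : Finset (Finset V) :=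
  H.edges.filter fun e => v ∈ e

/-- Every hyperedge has at most `f` vertices. -/
def Hypergraph.RankLE (H : Hypergraph V) (f : ℕ) : Prop :=
  ∀ e ∈ H.edges, e.card ≤ f

/-- Every vertex belongs to at most `D` hyperedges. -/
def Hypergraph.DegreeLE (H : Hypergraph V) (D : ℕ) : Prop :=
  ∀ v, (H.incident v).card ≤ D

/-- The variables of Algorithm MWHVC at the end of an iteration: the cover `C`, the levels `ℓ(v)`,
the deals and the dual variables `δ(e)`. -/
structure MState (V : Type) where
  cover : Finset V
  level : V → ℕ
  deal : Finset V → ℝ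
  dual : Finset V → ℝ

/-- The hyperedges that are not covered by `C`. -/
def Hypergraph.uncovered (H : Hypergraph V) (C : Finset V) : Finset (Finset V) :=
  H.edges.filter fun e => Disjoint e C

/-- `E'(v)`, the hyperedges that contain `v` and are not covered by `C`. -/
def Hypergraph.uncoveredAt (H : Hypergraph V) (C : Finset V) (v : V) : Finset (Finset V) :=
  (H.uncovered C).filter fun e => v ∈ e

/-- Iteration `0`: `C = ∅`, all levels are `0`, and
`deal(e) = δ(e) = 0.5 * min_{v ∈ e} w(v) / |E(v)|`. -/
def MState.init (H : Hypergraph V) (w : V → ℝ) : MState V :=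
  let d : Finset V → ℝ := fun e =>
    if h : e.Nonempty then (1 / 2) * e.inf' h (fun v => w v / ((H.incident v).card : ℝ)) else 0
  { cover := ∅, level := fun _ => 0, deal := d, dual := d }

/-- The load `∑_{e ∈ E(v)} δ(e)` of a vertex. -/
def MState.load (H : Hypergraph V) (S : MState V) (v : V) : ℝ :=
  ∑ e ∈ H.incident v, S.dual e

/-- The cover after the tightness check: every active vertex with `∑ δ(e) ≥ (1 - β) w(v)`
joins. -/
def MState.newCover (H : Hypergraph V) (w : V → ℝ) (β : ℝ) (S : MState V) : Finset V :=
  open Classical in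
  S.cover ∪ Finset.univ.filter fun v =>
    (H.uncoveredAt S.cover v).Nonempty ∧ (1 - β) * w v ≤ S.load H v

/-- The level of `v` after the loop
`while ∑ δ(e) > w(v) (1 - 0.5 ^ (ℓ(v) + 1)) do ℓ(v) := ℓ(v) + 1`,
which is executed by the active vertices, those in some hyperedge not covered by `C`. -/
def MState.newLevel (H : Hypergraph V) (w : V → ℝ) (S : MState V) (C : Finset V) (v : V) : ℕ :=
  open Classical in
  if (H.uncoveredAt C v).Nonempty then
    sInf {k : ℕ | S.level v ≤ k ∧ S.load H v ≤ w v * (1 - (1 / 2) ^ (k + 1))}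
  else S.level v

/-- One iteration `i ≥ 1` of Algorithm MWHVC, with tightness parameter `β`, multiplier `α`, and
with every dual variable of an uncovered hyperedge being increased by `s * deal(e)`.
The plain algorithm is `s = 1`; the version in which the level of a vertex increases at most once
per iteration is `s = 1 / 2`. -/
def MState.step (H : Hypergraph V) (w : V → ℝ) (β α s : ℝ) (S : MState V) : MState V :=
  open Classical in
  let C := S.newCover H w β
  let lev : V → ℕ := S.newLevel H w C
  -- every level increment of a vertex of `e` halves the deal of `e`
  let scaled : Finset V → ℝ := fun e => S.deal e * (1 / 2) ^ (∑ v ∈ e, (lev v - S.level v))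
  -- `v` sends `raise` (and otherwise `stuck`)
  let raise : V → Prop := fun v =>
    ∑ e ∈ H.uncoveredAt C v, scaled e ≤ (1 / α) * (1 / 2) ^ (lev v + 1) * w v
  let newDeal : Finset V → ℝ := fun e =>
    if e ∈ H.uncovered C then (if ∀ v ∈ e, raise v then α * scaled e else scaled e) else S.deal e
  { cover := C
    level := lev
    deal := newDeal
    dual := fun e => if e ∈ H.uncovered C then S.dual e + s * newDeal e else S.dual e }

/-- The state at the end of iteration `i`. -/
def MState.after (H : Hypergraph V) (w : V → ℝ) (β α s : ℝ) (i : ℕ) : MState V :=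
  (MState.step H w β α s)^[i] (MState.init H w)

/-- The number of communication rounds until termination, which happens in the first iteration
`i` at whose end all hyperedges are covered: two rounds for iteration `0` and four rounds for each
iteration `i ≥ 1` (vertices announce that they join the cover; hyperedges announce that they are
covered; vertices send level increments and `raise` / `stuck`; hyperedges send the deals). It is
`⊤` if the algorithm does not terminate. -/
def mwhvcRoundsOn (H : Hypergraph V) (w : V → ℝ) (β α s : ℝ) : ℕ∞ :=
  ⨅ (i : ℕ) (_ : H.uncovered (MState.after H w β α s i).cover = ∅), ((2 + 4 * i : ℕ) : ℕ∞)

end MWHVC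

/-- The multiplier `α`, as a function of the rank `f`, the maximum degree `D`, the approximation
parameter `ε` and the constant `γ`. -/
def multiplier (γ : ℝ) (f D : ℕ) (ε : ℝ) : ℝ :=
  let q : ℝ := Real.log D / (f * Real.log (f / ε) * Real.log (Real.log D))
  if Real.log D ^ (γ / 2) ≤ q then max 2 q else 2

/-- `T(f, D, ε)`: the worst-case round complexity of Algorithm MWHVC, in the version in which the
level of a vertex increases at most once per iteration, over all hypergraphs of rank at most `f`
and maximum degree at most `D` with positive vertex weights. Here `β = ε / (f + ε)`. -/
def mwhvcRounds (γ : ℝ) (f D : ℕ) (ε : ℝ) : ℕ∞ :=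
  ⨆ (k : ℕ) (H : Hypergraph (Fin k)) (w : Fin k → ℝ)
    (_ : H.RankLE f ∧ H.DegreeLE D ∧ ∀ v, 0 < w v),
    mwhvcRoundsOn H w (ε / (f + ε)) (multiplier γ f D ε) (1 / 2)

/-- The closed expression
`f log(f/ε) + log D / log log D + min {log D, f log(f/ε) (log D)^γ}`. -/
def closedBound (γ : ℝ) (f D : ℕ) (ε : ℝ) : ℝ :=
  f * Real.log (f / ε) + Real.log D / Real.log (Real.log D)
    + min (Real.log D) (f * Real.log (f / ε) * Real.log D ^ γ)

/-! ## Synchronous message passing with bounded messages -/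

/-- A deterministic distributed algorithm for nodes with identifiers in `N`, local inputs in `I`
and outputs in `O`. Messages are bit strings; local computation is not restricted. -/
structure DistAlgorithm (N I O : Type) where
  State : Type
  init : N → I → State
  /-- the message a node in a given state sends to a given neighbour -/
  send : State → N → List Bool
  /-- the new state, given the messages received, indexed by the sender -/
  receive : State → (N → List Bool) → State
  halted : State → Bool
  output : State → O

/-- The states of all nodes after `t` synchronous rounds on the network `G` with local inputs
`inp`. Messages travel along links of `G` only; a halted node is silent and keeps its state. -/
def DistAlgorithm.config {N I O : Type} (alg : DistAlgorithm N I O) (G : SimpleGraph N)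
    (inp : N → I) : ℕ → N → alg.State
  | 0 => fun v => alg.init v (inp v)
  | t + 1 => fun v =>
    open Classical in
    let S := alg.config G inp t
    if alg.halted (S v) then S v
    else alg.receive (S v) fun u =>
      if G.Adj u v ∧ alg.halted (S u) = false then alg.send (S u) v else []

/-- All messages that are sent in the execution have at most `bits` bits. -/
def DistAlgorithm.MessagesLE {N I O : Type} (alg : DistAlgorithm N I O) (G : SimpleGraph N)
    (inp : N → I) (bits : ℕ) : Prop :=
  ∀ (t : ℕ) (u v : N), G.Adj u v → alg.halted (alg.config G inp t u) = false →
    (alg.send (alg.config G inp t u) v).length ≤ bits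

/-- All nodes have halted after `R` rounds. -/
def DistAlgorithm.HaltsWithin {N I O : Type} (alg : DistAlgorithm N I O) (G : SimpleGraph N)
    (inp : N → I) (R : ℕ) : Prop :=
  ∀ v, alg.halted (alg.config G inp R v) = true

/-- `⌊log₂ N⌋ + 1`, the number of bits of a positive number `N`. -/
def bitSize (N : ℕ) : ℕ := Nat.log 2 N + 1

/-! ## Zero-one covering programs and their communication network -/

section Programs

variable {m n : ℕ}

/-- `f(A)`: the maximum number of nonzero entries in a row. -/
def rowSupport (A : Matrix (Fin m) (Fin n) ℝ) : ℕ :=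
  Finset.univ.sup fun i => (Finset.univ.filter fun j => A i j ≠ 0).card

/-- `Δ(A)`: the maximum number of nonzero entries in a column. -/
def colSupport (A : Matrix (Fin m) (Fin n) ℝ) : ℕ :=
  Finset.univ.sup fun j => (Finset.univ.filter fun i => A i j ≠ 0).card

/-- The program `min wᵀ x` subject to `A x ≥ b`, `x ∈ {0,1}ⁿ` is a covering program. -/
def IsCovering (A : Matrix (Fin m) (Fin n) ℝ) (b : Fin m → ℝ) (w : Fin n → ℝ) : Prop :=
  (∀ i j, 0 ≤ A i j) ∧ (∀ i, 0 ≤ b i) ∧ ∀ j, 0 ≤ w j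

/-- `x` is a zero-one vector with `A x ≥ b`. -/
def IsZeroOneSolution (A : Matrix (Fin m) (Fin n) ℝ) (b : Fin m → ℝ) (x : Fin n → ℝ) : Prop :=
  (∀ j, x j = 0 ∨ x j = 1) ∧ ∀ i, b i ≤ A.mulVec x i

/-- `x` is a zero-one solution whose weight is at most `ρ` times that of every zero-one
solution. -/
def IsApproxSolution (A : Matrix (Fin m) (Fin n) ℝ) (b : Fin m → ℝ) (w : Fin n → ℝ) (ρ : ℝ)
    (x : Fin n → ℝ) : Prop :=
  IsZeroOneSolution A b x ∧ ∀ y, IsZeroOneSolution A b y → w ⬝ᵥ x ≤ ρ * (w ⬝ᵥ y)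

/-- The bipartite communication network: variable nodes `Sum.inl j`, constraint nodes `Sum.inr i`,
and a link between `x_j` and `c_i` iff `A i j ≠ 0`. -/
def network (A : Matrix (Fin m) (Fin n) ℝ) : SimpleGraph (Fin n ⊕ Fin m) :=
  SimpleGraph.fromRel fun u v => ∃ j i, u = Sum.inl j ∧ v = Sum.inr i ∧ A i j ≠ 0

/-- Local inputs: a variable node has its weight and its column of `A`, a constraint node has its
right-hand side. -/
inductive LocalInput (m : ℕ) : Type
  | ofVariable (weight : ℝ) (column : Fin m → ℝ) : LocalInput m
  | ofConstraint (rhs : ℝ) : LocalInput m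

/-- The distribution of the input among the nodes. -/
def localInput (A : Matrix (Fin m) (Fin n) ℝ) (b : Fin m → ℝ) (w : Fin n → ℝ) :
    Fin n ⊕ Fin m → LocalInput m
  | Sum.inl j => LocalInput.ofVariable (w j) (fun i => A i j)
  | Sum.inr i => LocalInput.ofConstraint (b i)

/-- In the number format `dec`, the number `r` is represented by a string of at most `bits`
bits. -/
def HasCode (dec : List Bool → ℝ) (bits : ℕ) (r : ℝ) : Prop :=
  ∃ s : List Bool, s.length ≤ bits ∧ dec s = r

/-- All numbers of the input are represented by at most `bits` bits each. -/
def InputHasCodes (dec : List Bool → ℝ) (bits : ℕ) (A : Matrix (Fin m) (Fin n) ℝ)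
    (b : Fin m → ℝ) (w : Fin n → ℝ) : Prop :=
  (∀ i j, HasCode dec bits (A i j)) ∧ (∀ i, HasCode dec bits (b i)) ∧ ∀ j, HasCode dec bits (w j)

end Programs

end DistCover

end

/-! Since `A` is nonnegative, a zero-one vector violates constraint `i` exactly when the variables
of the row that it sets to zero form a set whose removal makes the row sum drop below `b i`. Hence
the program is a vertex cover problem. Its hyperedges are these forbidden sets of zeros, taken among
variables of positive weight; variables of weight zero are set to `1` for free (`coverHypergraph`,
`isApproxSolution_of_cover`). A hyperedge lies in a row, so the rank is at most `f`; a variable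
occurs in at most `Δ` rows with at most `2 ^ f` subsets each, so the degree is at most `2 ^ f * Δ`.

Algorithm MWHVC is a primal-dual method. No vertex is overloaded by the duals, a vertex joins the
cover only when its load is at least `(1 - β) w = f / (f + ε) * w`, and a dual is counted at most
`f` times. So the cover weighs at most `f + ε` times the sum of the duals, which bounds the weight
of every cover from below (`MState.sum_cover_le`).

There can be exponentially many hyperedges, so no node simulates them. Each variable learns the rows
in which it occurs and then recomputes the deals and duals of its own hyperedges. From the other
variables of its rows it needs their degrees once, and three bits per iteration: whether they are in
the cover, whether their level rises (by at most one, thanks to the increment `deal / 2`), and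
whether they raise (`statusNumber_eq`, `statusNumber_lt_two`). A constraint relays at most `f` bits
per step, which explains the factor `1 + f / log n`. As local computation is free, it is enough to
give transcripts in which each message is a function of the sender's view
(`exists_algorithm_of_transcript`).

Distributing the rows and the degrees costs `O(f)` times that factor. This is absorbed by `T`
because `f ≤ 4 T` (`rank_le_mwhvcRounds`): on a star with suitable weights, loads grow at most by a
factor `1 + α` per iteration, so about `log D / log (1 + α)` iterations are needed, while `D ≥ 2 ^
f` and `f log (1 + α) = O(log D)`.

The closed expression comes from a potential of an uncovered hyperedge (`MState.iteration_le`): in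
each iteration its deal is multiplied by `α`, or one of its vertices is stuck and loses a fraction
`1 / (4 α)` of its slack. Programs with at most one variable per row are solved directly in a
constant number of rounds. -/

namespace DistCover

set_option linter.unusedSectionVars false

/-! ## Distributed algorithms from transcripts -/

section Compile

variable {Ω N I O : Type}

/-- The state of a node that stores its identifier, its input and everything it has received. -/
structure ViewState (N I : Type) where
  time : ℕ
  node : N
  input : I
  received : ℕ → N → List Bool

/-- A view is consistent with the instance `P` of a family with transcripts `M`. -/
def ViewState.Consistent (inp : Ω → N → I) (M : Ω → ℕ → N → N → List Bool)
    (S : ViewState N I) (P : Ω) : Prop :=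
  inp P S.node = S.input ∧ ∀ s < S.time, ∀ u, M P s u S.node = S.received s u

open Classical in
/-- The algorithm in which every node acts as in an arbitrary instance that is consistent with its
view, and halts after `R` rounds. -/
noncomputable def transcriptAlgorithm [Inhabited O] (inp : Ω → N → I)
    (M : Ω → ℕ → N → N → List Bool) (out : Ω → N → O) (R : ℕ) : DistAlgorithm N I O where
  State := ViewState N I
  init v x := ⟨0, v, x, fun _ _ => []⟩
  send S u := if h : ∃ P, S.Consistent inp M P then M h.choose S.time S.node u else []
  receive S msg := ⟨S.time + 1, S.node, S.input, fun s => if s = S.time then msg else S.received s⟩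
  halted S := decide (R ≤ S.time)
  output S := if h : ∃ P, S.Consistent inp M P then out h.choose S.node else default

/-- The view of the node `v` at time `t`, when the transcript is that of the instance `P`. -/
def viewAt (inp : Ω → N → I) (M : Ω → ℕ → N → N → List Bool) (P : Ω) (t : ℕ) (v : N) :
    ViewState N I :=
  ⟨t, v, inp P v, fun s u => if s < t then M P s u v else []⟩

theorem viewAt_consistent (inp : Ω → N → I) (M : Ω → ℕ → N → N → List Bool) (P : Ω) (t : ℕ)
    (v : N) : (viewAt inp M P t v).Consistent inp M P :=
  ⟨rfl, fun s hs u => by simp only [viewAt] at hs ⊢; rw [if_pos hs]⟩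

/-- `viewAt` as a state of `transcriptAlgorithm`. -/
noncomputable def stateAt [Inhabited O] (inp : Ω → N → I) (M : Ω → ℕ → N → N → List Bool)
    (out : Ω → N → O) (R : ℕ) (P : Ω) (t : ℕ) (v : N) : (transcriptAlgorithm inp M out R).State :=
  viewAt inp M P t v

variable [Inhabited O] {G : Ω → SimpleGraph N} {inp : Ω → N → I}
  {M : Ω → ℕ → N → N → List Bool} {out : Ω → N → O} {R : ℕ}

/-- The instance chosen by the node need not be `P`, but it gives the node the same view, and by
`hloc` the view determines the messages. -/
theorem transcriptAlgorithm_send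
    (hloc : ∀ P P' v t, t < R → inp P v = inp P' v → (∀ s < t, ∀ u, M P s u v = M P' s u v) →
      ∀ u, M P t v u = M P' t v u) (P : Ω) {t : ℕ} (ht : t < R) (v u : N) :
    (transcriptAlgorithm inp M out R).send (stateAt inp M out R P t v) u = M P t v u := by
  have h : ∃ P', (viewAt inp M P t v).Consistent inp M P' := ⟨P, viewAt_consistent inp M P t v⟩
  have hc := h.choose_spec
  simp only [transcriptAlgorithm, stateAt]
  rw [dif_pos h]
  refine hloc _ _ v t ht hc.1 (fun s hs u => ?_) u
  have := hc.2 s hs u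
  rw [show (viewAt inp M P t v).node = v from rfl] at this
  rw [this]
  simp only [viewAt]
  rw [if_pos hs]

theorem transcriptAlgorithm_output
    (hout : ∀ P P' v, inp P v = inp P' v → (∀ s < R, ∀ u, M P s u v = M P' s u v) →
      out P v = out P' v) (P : Ω) (v : N) :
    (transcriptAlgorithm inp M out R).output (stateAt inp M out R P R v) = out P v := by
  have h : ∃ P', (viewAt inp M P R v).Consistent inp M P' := ⟨P, viewAt_consistent inp M P R v⟩
  have hc := h.choose_spec
  simp only [transcriptAlgorithm, stateAt]
  rw [dif_pos h]
  refine hout _ _ v hc.1 (fun s hs u => ?_)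
  have := hc.2 s hs u
  rw [show (viewAt inp M P R v).node = v from rfl] at this
  rw [this]
  simp only [viewAt]
  rw [if_pos hs]

open Classical in
-- The state is the true view of the transcript of `P`, frozen at time `R`, when all nodes halt
-- simultaneously.
theorem transcriptAlgorithm_config
    (hadj : ∀ P t u v, ¬ (G P).Adj u v → M P t u v = [])
    (hloc : ∀ P P' v t, t < R → inp P v = inp P' v → (∀ s < t, ∀ u, M P s u v = M P' s u v) →
      ∀ u, M P t v u = M P' t v u) (P : Ω) (t : ℕ) (v : N) :
    (transcriptAlgorithm inp M out R).config (G P) (inp P) t v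
      = stateAt inp M out R P (min t R) v := by
  induction t generalizing v with
  | zero => simp [DistAlgorithm.config, transcriptAlgorithm, stateAt, viewAt]
  | succ t ih =>
    rw [DistAlgorithm.config]
    have hh : ∀ u, (transcriptAlgorithm inp M out R).halted (stateAt inp M out R P (min t R) u)
        = decide (R ≤ t) := by
      intro u
      simp [transcriptAlgorithm, stateAt, viewAt]
    simp only [ih, hh]
    by_cases hR : R ≤ t
    · rw [if_pos (decide_eq_true hR), min_eq_right hR, min_eq_right (by omega)]
    · have h1 : min t R = t := by omega
      have h2 : min (t + 1) R = t + 1 := by omega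
      have hf : decide (R ≤ t) = false := decide_eq_false hR
      rw [if_neg (by rw [hf]; simp)]
      simp only [h1, h2, hf, and_true]
      have hm : (fun u => if (G P).Adj u v then
          (transcriptAlgorithm inp M out R).send (stateAt inp M out R P t u) v else [])
          = fun u => M P t u v := by
        funext u
        split_ifs with ha
        · exact transcriptAlgorithm_send hloc P (by omega) u v
        · exact (hadj P t u v ha).symm
      rw [hm]
      simp only [transcriptAlgorithm, stateAt, viewAt, ViewState.mk.injEq, true_and]
      funext s u
      by_cases hs : s = t
      · subst hs; simp
      · rw [if_neg hs]
        by_cases h : s < t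
        · rw [if_pos h, if_pos (by omega)]
        · rw [if_neg h, if_neg (by omega)]

/-- A family of transcripts in which what a node sends depends on its view only is the family of
executions of a distributed algorithm. -/
theorem exists_algorithm_of_transcript {bits : ℕ}
    (hadj : ∀ P t u v, ¬ (G P).Adj u v → M P t u v = [])
    (hlen : ∀ P t u v, t < R → (M P t u v).length ≤ bits)
    (hloc : ∀ P P' v t, t < R → inp P v = inp P' v → (∀ s < t, ∀ u, M P s u v = M P' s u v) →
      ∀ u, M P t v u = M P' t v u)
    (hout : ∀ P P' v, inp P v = inp P' v → (∀ s < R, ∀ u, M P s u v = M P' s u v) →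
      out P v = out P' v) :
    ∃ alg : DistAlgorithm N I O, ∀ P, alg.MessagesLE (G P) (inp P) bits ∧
      alg.HaltsWithin (G P) (inp P) R ∧ ∀ v, alg.output (alg.config (G P) (inp P) R v) = out P v := by
  refine ⟨transcriptAlgorithm inp M out R, fun P => ⟨?_, ?_, ?_⟩⟩
  · intro t u v _ hh
    rw [transcriptAlgorithm_config hadj hloc] at hh ⊢
    have ht : t < R := by
      by_contra hR
      simp [transcriptAlgorithm, stateAt, viewAt] at hh
      omega
    rw [min_eq_left ht.le, transcriptAlgorithm_send hloc P ht]
    exact hlen P t u v ht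
  · intro v
    rw [transcriptAlgorithm_config hadj hloc]
    simp [transcriptAlgorithm, stateAt, viewAt]
  · intro v
    rw [transcriptAlgorithm_config hadj hloc, min_self]
    exact transcriptAlgorithm_output hout P v

end Compile

/-! ## Long messages -/

/-- A list is determined by its consecutive chunks. -/
theorem eq_of_chunks_eq {α : Type} {l l' : List α} {b L : ℕ} (hb : 0 < b) (hl : l.length ≤ b * L)
    (hl' : l'.length ≤ b * L)
    (h : ∀ k < L, (l.drop (k * b)).take b = (l'.drop (k * b)).take b) : l = l' := by
  apply List.ext_getElem?
  intro x
  by_cases hx : x < b * L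
  · have hk : x / b < L := Nat.div_lt_of_lt_mul hx
    have h1 := congrArg (fun q => q[x % b]?) (h _ hk)
    have h2 : x / b * b + x % b = x := by rw [mul_comm]; exact Nat.div_add_mod x b
    simpa [List.getElem?_take, Nat.mod_lt x hb, List.getElem?_drop, h2] using h1
  · rw [List.getElem?_eq_none (by omega), List.getElem?_eq_none (by omega)]

/-- The step to which the round `r` belongs, when the step `t` takes `L t` rounds. -/
def stepOf (L : ℕ → ℕ) (r : ℕ) : ℕ :=
  Nat.findGreatest (fun t => ∑ s ∈ Finset.range t, L s ≤ r) r

/-- The partial sums of `L` are strictly increasing, so the intervals of rounds of different steps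
are disjoint. -/
theorem stepOf_eq {L : ℕ → ℕ} (hL : ∀ t, 0 < L t) {t k : ℕ} (hk : k < L t) :
    stepOf L (∑ s ∈ Finset.range t, L s + k) = t := by
  have hmono : StrictMono fun t => ∑ s ∈ Finset.range t, L s :=
    strictMono_nat_of_lt_succ fun t => by rw [Finset.sum_range_succ]; have := hL t; omega
  have hge : t ≤ ∑ s ∈ Finset.range t, L s := hmono.le_apply (x := t)
  refine (Nat.findGreatest_eq_iff).2 ⟨by omega, fun _ => by omega, fun n hn _ h => ?_⟩
  have h1 : ∑ s ∈ Finset.range (t + 1), L s ≤ ∑ s ∈ Finset.range n, L s :=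
    hmono.monotone hn
  rw [Finset.sum_range_succ] at h1
  omega

theorem exists_step_offset {L : ℕ → ℕ} {τ r : ℕ} (hr : r < ∑ s ∈ Finset.range τ, L s) :
    ∃ t < τ, ∃ k < L t, r = ∑ s ∈ Finset.range t, L s + k := by
  induction τ with
  | zero => simp at hr
  | succ τ ih =>
    by_cases h : r < ∑ s ∈ Finset.range τ, L s
    · obtain ⟨t, ht, k, hk⟩ := ih h
      exact ⟨t, by omega, k, hk⟩
    · rw [Finset.sum_range_succ] at hr
      exact ⟨τ, by omega, r - ∑ s ∈ Finset.range τ, L s, by omega, by omega⟩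

/-- `exists_algorithm_of_transcript` for messages of `bits * L t` bits in step `t`, each of which is
sent in `L t` rounds. -/
theorem exists_algorithm_of_long_transcript {Ω N I O : Type} [Inhabited O]
    {G : Ω → SimpleGraph N} {inp : Ω → N → I} {M : Ω → ℕ → N → N → List Bool} {out : Ω → N → O}
    {τ bits : ℕ} {L : ℕ → ℕ} (hbits : 0 < bits) (hL : ∀ t, 0 < L t)
    (hadj : ∀ P t u v, ¬ (G P).Adj u v → M P t u v = [])
    (hlen : ∀ P t u v, t < τ → (M P t u v).length ≤ bits * L t)
    (hloc : ∀ P P' v t, t < τ → inp P v = inp P' v → (∀ s < t, ∀ u, M P s u v = M P' s u v) →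
      ∀ u, M P t v u = M P' t v u)
    (hout : ∀ P P' v, inp P v = inp P' v → (∀ s < τ, ∀ u, M P s u v = M P' s u v) →
      out P v = out P' v) :
    ∃ alg : DistAlgorithm N I O, ∀ P, alg.MessagesLE (G P) (inp P) bits ∧
      alg.HaltsWithin (G P) (inp P) (∑ t ∈ Finset.range τ, L t) ∧
      ∀ v, alg.output (alg.config (G P) (inp P) (∑ t ∈ Finset.range τ, L t) v) = out P v := by
  have hmono : StrictMono fun t => ∑ s ∈ Finset.range t, L s :=
    strictMono_nat_of_lt_succ fun t => by rw [Finset.sum_range_succ]; have := hL t; omega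
  -- In round `r` the chunk is sent whose index is the offset of `r` within its step.
  let m : Ω → ℕ → N → N → List Bool := fun P r u v =>
    ((M P (stepOf L r) u v).drop ((r - ∑ s ∈ Finset.range (stepOf L r), L s) * bits)).take bits
  have hm : ∀ P t k u v, k < L t → m P (∑ s ∈ Finset.range t, L s + k) u v
      = ((M P t u v).drop (k * bits)).take bits := by
    intro P t k u v hk
    simp only [m, stepOf_eq hL hk, Nat.add_sub_cancel_left]
  have hfull : ∀ P P' v t, t ≤ τ → (∀ r < ∑ s ∈ Finset.range t, L s, ∀ u, m P r u v = m P' r u v) →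
      ∀ s < t, ∀ u, M P s u v = M P' s u v := by
    intro P P' v t ht h s hs u
    refine eq_of_chunks_eq hbits (hlen P s u v (by omega)) (hlen P' s u v (by omega)) fun k hk => ?_
    have h1 : ∑ s' ∈ Finset.range (s + 1), L s' ≤ ∑ s' ∈ Finset.range t, L s' := hmono.monotone hs
    rw [Finset.sum_range_succ] at h1
    have := h (∑ s' ∈ Finset.range s, L s' + k) (by omega) u
    rwa [hm _ _ _ _ _ hk, hm _ _ _ _ _ hk] at this
  refine exists_algorithm_of_transcript (M := m) ?_ ?_ ?_ ?_
  · intro P t u v h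
    simp [m, hadj P _ u v h]
  · intro P t u v _
    simp only [m, List.length_take]
    exact min_le_left _ _
  · intro P P' v r hr hi h u
    obtain ⟨t, ht, k, hk, rfl⟩ := exists_step_offset hr
    rw [hm _ _ _ _ _ hk, hm _ _ _ _ _ hk,
      hloc P P' v t ht hi (hfull P P' v t ht.le fun r hr => h r (by omega)) u]
  · intro P P' v hi h
    exact hout P P' v hi (hfull P P' v τ le_rfl h)

/-! ## Encodings by bit strings of fixed length -/

/-- The `l` lowest bits of `x`. -/
def natBits (l x : ℕ) : List Bool := List.ofFn fun i : Fin l => x.testBit i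

@[simp] theorem length_natBits (l x : ℕ) : (natBits l x).length = l := by simp [natBits]

theorem natBits_inj {l x y : ℕ} (hx : x < 2 ^ l) (hy : y < 2 ^ l) (h : natBits l x = natBits l y) :
    x = y := by
  refine Nat.eq_of_testBit_eq fun i => ?_
  by_cases hi : i < l
  · exact congrFun (List.ofFn_injective h) ⟨i, hi⟩
  · have hp : 2 ^ l ≤ 2 ^ i := Nat.pow_le_pow_right (by norm_num) (by omega)
    rw [Nat.testBit_lt_two_pow (hx.trans_le hp), Nat.testBit_lt_two_pow (hy.trans_le hp)]

/-- A bit string of length at most `K`, encoded with `2 * K` bits. -/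
def padBits (K : ℕ) (s : List Bool) : List Bool :=
  (List.ofFn fun i : Fin K => s[(i : ℕ)]?.isSome) ++ List.ofFn fun i : Fin K => s[(i : ℕ)]?.getD false

@[simp] theorem length_padBits (K : ℕ) (s : List Bool) : (padBits K s).length = 2 * K := by
  simp [padBits, two_mul]

theorem padBits_inj {K : ℕ} {s s' : List Bool} (hs : s.length ≤ K) (hs' : s'.length ≤ K)
    (h : padBits K s = padBits K s') : s = s' := by
  obtain ⟨h1, h2⟩ := List.append_inj h (by simp)
  refine List.ext_getElem? fun i => ?_
  by_cases hi : i < K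
  · have h3 := congrFun (List.ofFn_injective h1) ⟨i, hi⟩
    have h4 := congrFun (List.ofFn_injective h2) ⟨i, hi⟩
    simp only at h3 h4
    revert h3 h4
    rcases s[i]? with _ | a <;> rcases s'[i]? with _ | a' <;> simp
  · rw [List.getElem?_eq_none (by omega), List.getElem?_eq_none (by omega)]

open Classical in
/-- An encoding of the numbers that have a code of at most `K` bits. -/
noncomputable def realBits (dec : List Bool → ℝ) (K : ℕ) (r : ℝ) : List Bool :=
  padBits K (if h : HasCode dec K r then h.choose else [])

@[simp] theorem length_realBits (dec : List Bool → ℝ) (K : ℕ) (r : ℝ) :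
    (realBits dec K r).length = 2 * K := length_padBits _ _

theorem realBits_inj {dec : List Bool → ℝ} {K : ℕ} {r r' : ℝ} (hr : HasCode dec K r)
    (hr' : HasCode dec K r') (h : realBits dec K r = realBits dec K r') : r = r' := by
  rw [realBits, realBits, dif_pos hr, dif_pos hr'] at h
  have := padBits_inj hr.choose_spec.1 hr'.choose_spec.1 h
  rw [← hr.choose_spec.2, ← hr'.choose_spec.2, this]

/-- Blocks of a known length can be cut off one after the other. The length must be positive, as
otherwise the number of blocks would be lost. -/
theorem eq_of_flatten_eq {α : Type} {l : ℕ} (hl : 0 < l) {a b : List (List α)}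
    (ha : ∀ x ∈ a, x.length = l) (hb : ∀ x ∈ b, x.length = l) (h : a.flatten = b.flatten) :
    a = b := by
  induction a generalizing b with
  | nil =>
    rcases b with _ | ⟨y, b⟩
    · rfl
    · have := congrArg List.length h
      simp [hb y (by simp)] at this
      omega
  | cons x a ih =>
    rcases b with _ | ⟨y, b⟩
    · have := congrArg List.length h
      simp [ha x (by simp)] at this
      omega
    · rw [List.flatten_cons, List.flatten_cons] at h
      obtain ⟨h1, h2⟩ := List.append_inj h (by rw [ha x (by simp), hb y (by simp)])
      rw [h1, ih (fun z hz => ha z (by simp [hz])) (fun z hz => hb z (by simp [hz])) h2]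

theorem length_flatten_of_forall {α : Type} {l : ℕ} {a : List (List α)}
    (ha : ∀ x ∈ a, x.length = l) : a.flatten.length = a.length * l := by
  induction a with
  | nil => simp
  | cons x a ih =>
    rw [List.flatten_cons, List.length_append, ha x (by simp), ih fun z hz => ha z (by simp [hz]),
      List.length_cons]
    ring

/-! ## Broadcasting within the rows of a covering program -/

section Broadcast

variable {m n : ℕ}

/-- The variables that occur in the `i`-th constraint. -/
noncomputable def rowVars (A : Matrix (Fin m) (Fin n) ℝ) (i : Fin m) : Finset (Fin n) :=
  Finset.univ.filter fun j => A i j ≠ 0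

@[simp] theorem mem_rowVars {A : Matrix (Fin m) (Fin n) ℝ} {i : Fin m} {j : Fin n} :
    j ∈ rowVars A i ↔ A i j ≠ 0 := by simp [rowVars]

theorem card_rowVars_le (A : Matrix (Fin m) (Fin n) ℝ) (i : Fin m) :
    (rowVars A i).card ≤ rowSupport A := by
  exact Finset.le_sup (f := fun i => (Finset.univ.filter fun j => A i j ≠ 0).card)
    (Finset.mem_univ i)

theorem network_adj {A : Matrix (Fin m) (Fin n) ℝ} {u v : Fin n ⊕ Fin m} :
    (network A).Adj u v ↔ ∃ j i, A i j ≠ 0 ∧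
      ((u = Sum.inl j ∧ v = Sum.inr i) ∨ (u = Sum.inr i ∧ v = Sum.inl j)) := by
  rw [network, SimpleGraph.fromRel_adj]
  constructor
  · rintro ⟨_, ⟨j, i, rfl, rfl, h⟩ | ⟨j, i, rfl, rfl, h⟩⟩
    · exact ⟨j, i, h, Or.inl ⟨rfl, rfl⟩⟩
    · exact ⟨j, i, h, Or.inr ⟨rfl, rfl⟩⟩
  · rintro ⟨j, i, h, ⟨rfl, rfl⟩ | ⟨rfl, rfl⟩⟩
    · exact ⟨by simp, Or.inl ⟨j, i, rfl, rfl, h⟩⟩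
    · exact ⟨by simp, Or.inr ⟨j, i, rfl, rfl, h⟩⟩

/-- Two covering programs are the same for the `j`-th variable: they have the same data of this
variable and of its constraints and their variables. -/
structure SameAround (A A' : Matrix (Fin m) (Fin n) ℝ) (b b' : Fin m → ℝ) (w w' : Fin n → ℝ)
    (j : Fin n) : Prop where
  weight : w j = w' j
  column : ∀ i, A i j = A' i j
  rhs : ∀ i, A i j ≠ 0 → b i = b' i
  row : ∀ i, A i j ≠ 0 → ∀ k, A i k = A' i k
  row_weight : ∀ i, A i j ≠ 0 → ∀ k, A i k ≠ 0 → w k = w' k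

variable (dec : List Bool → ℝ) (K s : ℕ) (l : ℕ → ℕ)

/-- What the `j`-th variable tells the `i`-th constraint in phase `p`: its identifier, coefficient
and weight in phase `0`, and the number `X p j` of `l p` bits in phase `p + 1`. -/
noncomputable def reportBits (A : Matrix (Fin m) (Fin n) ℝ) (w : Fin n → ℝ) (X : ℕ → Fin n → ℕ)
    (i : Fin m) (j : Fin n) : ℕ → List Bool
  | 0 => natBits s j ++ (realBits dec K (A i j) ++ realBits dec K (w j))
  | p + 1 => natBits (l p) (X p j)

/-- The length of the reports in phase `p`. -/
def reportLength : ℕ → ℕ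
  | 0 => s + 4 * K
  | p + 1 => l p

theorem length_reportBits (A : Matrix (Fin m) (Fin n) ℝ) (w : Fin n → ℝ) (X : ℕ → Fin n → ℕ)
    (i : Fin m) (j : Fin n) (p : ℕ) :
    (reportBits dec K s l A w X i j p).length = reportLength K s l p := by
  cases p with
  | zero => simp [reportBits, reportLength]; ring
  | succ p => simp [reportBits, reportLength]

/-- The answer of the `i`-th constraint in phase `p`: its right-hand side and the reports of all its
variables. -/
noncomputable def answerBits (A : Matrix (Fin m) (Fin n) ℝ) (b : Fin m → ℝ) (w : Fin n → ℝ)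
    (X : ℕ → Fin n → ℕ) (i : Fin m) (p : ℕ) : List Bool :=
  realBits dec K (b i)
    ++ (((rowVars A i).sort (· ≤ ·)).map fun j => reportBits dec K s l A w X i j p).flatten

theorem length_answerBits_le (A : Matrix (Fin m) (Fin n) ℝ) (b : Fin m → ℝ) (w : Fin n → ℝ)
    (X : ℕ → Fin n → ℕ) (i : Fin m) (p : ℕ) :
    (answerBits dec K s l A b w X i p).length ≤ 2 * K + rowSupport A * reportLength K s l p := by
  rw [answerBits, List.length_append, length_realBits, length_flatten_of_forall (l :=
    reportLength K s l p) (by simp [length_reportBits])]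
  simp only [List.length_map, Finset.length_sort]
  exact Nat.add_le_add_left (Nat.mul_le_mul_right _ (card_rowVars_le A i)) _

open Classical in
/-- The messages: a report phase and an answer phase alternate. -/
noncomputable def broadcastMessage (A : Matrix (Fin m) (Fin n) ℝ) (b : Fin m → ℝ) (w : Fin n → ℝ)
    (X : ℕ → Fin n → ℕ) (t : ℕ) : Fin n ⊕ Fin m → Fin n ⊕ Fin m → List Bool
  | Sum.inl j, Sum.inr i =>
    if A i j ≠ 0 ∧ t % 2 = 0 then reportBits dec K s l A w X i j (t / 2) else []
  | Sum.inr i, Sum.inl j =>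
    if A i j ≠ 0 ∧ t % 2 = 1 then answerBits dec K s l A b w X i (t / 2) else []
  | _, _ => []

variable {dec K s l} {A A' : Matrix (Fin m) (Fin n) ℝ} {b b' : Fin m → ℝ} {w w' : Fin n → ℝ}
  {X X' : ℕ → Fin n → ℕ}

theorem rhs_eq_of_answerBits_eq {i : Fin m} {p : ℕ} (hb : HasCode dec K (b i))
    (hb' : HasCode dec K (b' i))
    (h : answerBits dec K s l A b w X i p = answerBits dec K s l A' b' w' X' i p) : b i = b' i :=
  realBits_inj hb hb' (List.append_inj h (by simp)).1

theorem reports_eq_of_answerBits_eq {i : Fin m} {p : ℕ} (hl : 0 < reportLength K s l p)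
    (h : answerBits dec K s l A b w X i p = answerBits dec K s l A' b' w' X' i p) :
    ((rowVars A i).sort (· ≤ ·)).map (fun j => reportBits dec K s l A w X i j p)
      = ((rowVars A' i).sort (· ≤ ·)).map fun j => reportBits dec K s l A' w' X' i j p :=
  eq_of_flatten_eq hl (by simp [length_reportBits]) (by simp [length_reportBits])
    (List.append_inj h (by simp)).2

/-- The reports of phase `0` contain identifiers, so the answer reveals which variables occur in the
row as well as their data; coefficients of absent variables are zero. -/
theorem row_eq_of_answerBits_eq {i : Fin m} (hs : 0 < s) (hn : n ≤ 2 ^ s)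
    (hA : InputHasCodes dec K A b w) (hA' : InputHasCodes dec K A' b' w')
    (h : answerBits dec K s l A b w X i 0 = answerBits dec K s l A' b' w' X' i 0) :
    (∀ k, A i k = A' i k) ∧ ∀ k, A i k ≠ 0 → w k = w' k := by
  have h1 := reports_eq_of_answerBits_eq (by simp only [reportLength]; omega) h
  have hlen := congrArg List.length h1
  simp only [List.length_map] at hlen
  have hent : ∀ x (hx : x < ((rowVars A i).sort (· ≤ ·)).length)
      (hx' : x < ((rowVars A' i).sort (· ≤ ·)).length),
      ((rowVars A i).sort (· ≤ ·))[x] = ((rowVars A' i).sort (· ≤ ·))[x] ∧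
      A i (((rowVars A i).sort (· ≤ ·))[x]) = A' i (((rowVars A' i).sort (· ≤ ·))[x]) ∧
      w (((rowVars A i).sort (· ≤ ·))[x]) = w' (((rowVars A' i).sort (· ≤ ·))[x]) := by
    intro x hx hx'
    have h2 := congrArg (fun q => q[x]?) h1
    simp only [List.getElem?_map, List.getElem?_eq_getElem hx, List.getElem?_eq_getElem hx',
      Option.map_some, Option.some.injEq, reportBits] at h2
    obtain ⟨h3, h4⟩ := List.append_inj h2 (by simp)
    obtain ⟨h4, h5⟩ := List.append_inj h4 (by simp)
    exact ⟨Fin.ext (natBits_inj (lt_of_lt_of_le (Fin.isLt _) hn) (lt_of_lt_of_le (Fin.isLt _) hn) h3),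
      realBits_inj (hA.1 _ _) (hA'.1 _ _) h4, realBits_inj (hA.2.2 _) (hA'.2.2 _) h5⟩
  have hsort : (rowVars A i).sort (· ≤ ·) = (rowVars A' i).sort (· ≤ ·) :=
    List.ext_getElem hlen fun x hx hx' => (hent x hx hx').1
  have hvars : rowVars A i = rowVars A' i := by
    rw [← Finset.sort_toFinset (rowVars A i) (· ≤ ·), hsort, Finset.sort_toFinset]
  have hmem : ∀ k, A i k ≠ 0 → A i k = A' i k ∧ w k = w' k := by
    intro k hk
    have : k ∈ (rowVars A i).sort (· ≤ ·) := by simpa using hk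
    obtain ⟨x, hx, rfl⟩ := List.getElem_of_mem this
    have h6 := hent x hx (hsort ▸ hx)
    rw [← h6.1] at h6
    exact h6.2
  refine ⟨fun k => ?_, fun k hk => (hmem k hk).2⟩
  by_cases hk : A i k = 0
  · have : k ∉ rowVars A' i := by rw [← hvars]; simp [hk]
    rw [mem_rowVars, not_not] at this
    rw [hk, this]
  · exact (hmem k hk).1

theorem value_eq_of_answerBits_eq {i : Fin m} {p : ℕ} (hl : 0 < l p) (hrow : ∀ k, A i k = A' i k)
    (hX : ∀ k, X p k < 2 ^ l p) (hX' : ∀ k, X' p k < 2 ^ l p)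
    (h : answerBits dec K s l A b w X i (p + 1) = answerBits dec K s l A' b' w' X' i (p + 1)) :
    ∀ k, A i k ≠ 0 → X p k = X' p k := by
  intro k hk
  have h1 := reports_eq_of_answerBits_eq (by simpa only [reportLength]) h
  have hvars : rowVars A' i = rowVars A i := by ext k; simp [hrow]
  rw [hvars] at h1
  have h2 := List.map_inj_left.1 h1 k (by simpa using hk)
  exact natBits_inj (hX k) (hX' k) h2

/-- Numbers `X p j` and outputs that the `j`-th variable can compute from what its constraints and
their variables know initially and from the previous numbers of these variables are computed by a
distributed algorithm. -/
theorem exists_algorithm_of_broadcast {Ω : Type} {A : Ω → Matrix (Fin m) (Fin n) ℝ}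
    {b : Ω → Fin m → ℝ} {w : Ω → Fin n → ℝ} {X : Ω → ℕ → Fin n → ℕ} {out : Ω → Fin n → ℝ}
    {f T bits : ℕ} {L : ℕ → ℕ} (hs : 0 < s) (hn : n ≤ 2 ^ s) (hl : ∀ p, 0 < l p)
    (hcode : ∀ P, InputHasCodes dec K (A P) (b P) (w P)) (hf : ∀ P, rowSupport (A P) ≤ f)
    (hX : ∀ P p j, X P p j < 2 ^ l p) (hbits : 0 < bits) (hL : ∀ t, 0 < L t)
    (hL0 : ∀ p ≤ T, reportLength K s l p ≤ bits * L (2 * p))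
    (hL1 : ∀ p ≤ T, 2 * K + f * reportLength K s l p ≤ bits * L (2 * p + 1))
    (hloc : ∀ P P' j p, p < T → SameAround (A P) (A P') (b P) (b P') (w P) (w P') j →
      (∀ q < p, ∀ i, A P i j ≠ 0 → ∀ k, A P i k ≠ 0 → X P q k = X P' q k) → X P p j = X P' p j)
    (hout : ∀ P P' j, SameAround (A P) (A P') (b P) (b P') (w P) (w P') j →
      (∀ q < T, ∀ i, A P i j ≠ 0 → ∀ k, A P i k ≠ 0 → X P q k = X P' q k) →
      out P j = out P' j) :
    ∃ alg : DistAlgorithm (Fin n ⊕ Fin m) (LocalInput m) ℝ, ∀ P,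
      alg.MessagesLE (network (A P)) (localInput (A P) (b P) (w P)) bits ∧
      alg.HaltsWithin (network (A P)) (localInput (A P) (b P) (w P))
        (∑ t ∈ Finset.range (2 * (T + 1)), L t) ∧
      ∀ j, alg.output (alg.config (network (A P)) (localInput (A P) (b P) (w P))
        (∑ t ∈ Finset.range (2 * (T + 1)), L t) (Sum.inl j)) = out P j := by
  have hrl : ∀ p, 0 < reportLength K s l p := by
    intro p
    cases p with
    | zero => simp only [reportLength]; omega
    | succ p => exact hl p
  -- what the answers of the first phases tell a variable
  have hview : ∀ P P' j p, 0 < p →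
      localInput (A P) (b P) (w P) (Sum.inl j) = localInput (A P') (b P') (w P') (Sum.inl j) →
      (∀ t < 2 * p, ∀ u, broadcastMessage dec K s l (A P) (b P) (w P) (X P) t u (Sum.inl j)
        = broadcastMessage dec K s l (A P') (b P') (w P') (X P') t u (Sum.inl j)) →
      SameAround (A P) (A P') (b P) (b P') (w P) (w P') j ∧
      ∀ q, q + 1 < p → ∀ i, A P i j ≠ 0 → ∀ k, A P i k ≠ 0 → X P q k = X P' q k := by
    intro P P' j p hp hi h
    simp only [localInput, LocalInput.ofVariable.injEq] at hi
    have hcol : ∀ i, A P i j = A P' i j := congrFun hi.2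
    have hans : ∀ q < p, ∀ i, A P i j ≠ 0 →
        answerBits dec K s l (A P) (b P) (w P) (X P) i q
          = answerBits dec K s l (A P') (b P') (w P') (X P') i q := by
      intro q hq i hij
      have h1 := h (2 * q + 1) (by omega) (Sum.inr i)
      have h2 : (2 * q + 1) / 2 = q := by omega
      have h3 : (2 * q + 1) % 2 = 1 := by omega
      have hij' := hij
      rw [hcol] at hij'
      simpa only [broadcastMessage, h2, h3, hij, hij', ne_eq, not_false_eq_true, and_self, if_true]
        using h1
    have hrow := fun i hij => row_eq_of_answerBits_eq hs hn (hcode P) (hcode P') (hans 0 hp i hij)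
    refine ⟨⟨hi.1, hcol, fun i hij => rhs_eq_of_answerBits_eq ((hcode P).2.1 i) ((hcode P').2.1 i)
      (hans 0 hp i hij), fun i hij => (hrow i hij).1, fun i hij => (hrow i hij).2⟩, ?_⟩
    intro q hq i hij
    exact value_eq_of_answerBits_eq (hl q) (hrow i hij).1 (hX P q) (hX P' q) (hans (q + 1) hq i hij)
  refine (exists_algorithm_of_long_transcript (Ω := Ω) (G := fun P => network (A P))
    (inp := fun P => localInput (A P) (b P) (w P))
    (M := fun P => broadcastMessage dec K s l (A P) (b P) (w P) (X P))
    (out := fun P => Sum.elim (out P) fun _ => 0) (τ := 2 * (T + 1)) hbits hL ?_ ?_ ?_ ?_).imp fun alg halg P =>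
      ⟨(halg P).1, (halg P).2.1, fun j => (halg P).2.2 (Sum.inl j)⟩
  · intro P t u v h
    rcases u with j | i <;> rcases v with j' | i' <;> simp only [broadcastMessage]
    · exact if_neg fun hA => h (network_adj.2 ⟨j, i', hA.1, Or.inl ⟨rfl, rfl⟩⟩)
    · exact if_neg fun hA => h (network_adj.2 ⟨j', i, hA.1, Or.inr ⟨rfl, rfl⟩⟩)
  · intro P t u v ht
    have ht' : t / 2 ≤ T := by omega
    rcases u with j | i <;> rcases v with j' | i' <;> simp only [broadcastMessage]
    · simp
    · split_ifs with h
      · rw [length_reportBits]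
        have := hL0 _ ht'
        rwa [show 2 * (t / 2) = t by omega] at this
      · simp
    · split_ifs with h
      · refine (length_answerBits_le dec K s l (A P) (b P) (w P) (X P) i (t / 2)).trans ?_
        have := hL1 _ ht'
        rw [show 2 * (t / 2) + 1 = t by omega] at this
        exact le_trans (Nat.add_le_add_left (Nat.mul_le_mul_right _ (hf P)) _) this
      · simp
    · simp
  · intro P P' v t ht hi h u
    rcases v with j | i <;> rcases u with j' | i' <;> simp only [broadcastMessage]
    · have hi' := hi
      simp only [localInput, LocalInput.ofVariable.injEq] at hi'
      have hcol : A P i' j = A P' i' j := congrFun hi'.2 i'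
      simp only [← hcol]
      by_cases hev : t % 2 = 0
      swap
      · simp [hev]
      refine if_congr Iff.rfl ?_ rfl
      obtain ⟨p, rfl⟩ : ∃ p, t = 2 * p := ⟨t / 2, by omega⟩
      rw [show 2 * p / 2 = p by omega]
      cases p with
      | zero => simp only [reportBits, ← hcol, ← hi'.1]
      | succ p =>
        obtain ⟨h1, h2⟩ := hview P P' j (p + 1) (by omega) hi h
        simp only [reportBits]
        rw [hloc P P' j p (by omega) h1 fun q hq => h2 q (by omega)]
    · simp only [localInput, LocalInput.ofConstraint.injEq] at hi
      by_cases hodd : t % 2 = 1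
      swap
      · simp [hodd]
      obtain ⟨p, rfl⟩ : ∃ p, t = 2 * p + 1 := ⟨t / 2, by omega⟩
      -- The answer to be sent depends only on the reports of the step just before it.
      have hrep : ∀ k, (if A P i k ≠ 0 then reportBits dec K s l (A P) (w P) (X P) i k p else [])
          = if A P' i k ≠ 0 then reportBits dec K s l (A P') (w P') (X P') i k p else [] := by
        intro k
        have := h (2 * p) (by omega) (Sum.inl k)
        simpa [broadcastMessage] using this
      -- A constraint is not given its row. It recognises its variables by the fact that reports are
      -- nonempty, while absent variables are silent.
      have hne : ∀ k, A P i k ≠ 0 ↔ A P' i k ≠ 0 := by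
        intro k
        have h1 := congrArg List.length (hrep k)
        have h2 := hrl p
        by_cases h3 : A P i k = 0 <;> by_cases h4 : A P' i k = 0 <;>
          simp [h3, h4, length_reportBits] at h1 ⊢ <;> omega
      have hvars : rowVars (A P) i = rowVars (A P') i := by ext k; simpa using hne k
      rw [show (2 * p + 1) / 2 = p by omega, answerBits, answerBits, hi, hvars]
      have hmap : ((rowVars (A P') i).sort (· ≤ ·)).map
            (fun j => reportBits dec K s l (A P) (w P) (X P) i j p)
          = ((rowVars (A P') i).sort (· ≤ ·)).map
            fun j => reportBits dec K s l (A P') (w P') (X P') i j p := by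
        refine List.map_congr_left fun k hk => ?_
        have hk' : A P' i k ≠ 0 := by simpa using hk
        have := hrep k
        rwa [if_pos hk', if_pos ((hne k).2 hk')] at this
      rw [hmap]
      exact if_congr (and_congr_left' (hne j')) rfl rfl
  · intro P P' v hi h
    rcases v with j | i
    · obtain ⟨h1, h2⟩ := hview P P' j (T + 1) (by omega) hi h
      exact hout P P' j h1 fun q hq => h2 q (by omega)
    · rfl

end Broadcast

/-! ## Invariants of Algorithm MWHVC -/

section Invariants

variable {V : Type} [Fintype V] [DecidableEq V] {H : Hypergraph V} {w : V → ℝ} {β α : ℝ}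
  {S : MState V} {v : V} {e : Finset V}

theorem Hypergraph.mem_incident : e ∈ H.incident v ↔ e ∈ H.edges ∧ v ∈ e := by
  simp [Hypergraph.incident]

theorem Hypergraph.mem_uncovered {C : Finset V} : e ∈ H.uncovered C ↔ e ∈ H.edges ∧ Disjoint e C := by
  simp [Hypergraph.uncovered]

theorem Hypergraph.mem_uncoveredAt {C : Finset V} :
    e ∈ H.uncoveredAt C v ↔ e ∈ H.uncovered C ∧ v ∈ e := by
  simp [Hypergraph.uncoveredAt]

theorem Hypergraph.uncovered_anti {C C' : Finset V} (h : C ⊆ C') : H.uncovered C' ⊆ H.uncovered C :=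
  fun e he => by
    rw [Hypergraph.mem_uncovered] at he ⊢
    exact ⟨he.1, he.2.mono_right h⟩

theorem Hypergraph.uncoveredAt_anti {C C' : Finset V} (h : C ⊆ C') (v : V) :
    H.uncoveredAt C' v ⊆ H.uncoveredAt C v := fun e he => by
  rw [Hypergraph.mem_uncoveredAt] at he ⊢
  exact ⟨Hypergraph.uncovered_anti h he.1, he.2⟩

theorem Hypergraph.uncoveredAt_subset_incident (C : Finset V) (v : V) :
    H.uncoveredAt C v ⊆ H.incident v := fun e he => by
  rw [Hypergraph.mem_uncoveredAt, Hypergraph.mem_uncovered] at he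
  exact Hypergraph.mem_incident.2 ⟨he.1.1, he.2⟩

theorem MState.mem_newCover : v ∈ S.newCover H w β ↔
    v ∈ S.cover ∨ (H.uncoveredAt S.cover v).Nonempty ∧ (1 - β) * w v ≤ S.load H v := by
  simp [MState.newCover]

theorem MState.cover_subset_newCover : S.cover ⊆ S.newCover H w β := fun _ hv =>
  MState.mem_newCover.2 (Or.inl hv)

/-- The deal of `e` after the level increments of its vertices. -/
noncomputable def MState.scaledDeal (H : Hypergraph V) (w : V → ℝ) (β : ℝ) (S : MState V)
    (e : Finset V) : ℝ :=
  S.deal e * (1 / 2) ^ (∑ v ∈ e, (S.newLevel H w (S.newCover H w β) v - S.level v))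

/-- `v` sends `raise`. -/
def MState.Raises (H : Hypergraph V) (w : V → ℝ) (β α : ℝ) (S : MState V) (v : V) : Prop :=
  ∑ e ∈ H.uncoveredAt (S.newCover H w β) v, S.scaledDeal H w β e
    ≤ (1 / α) * (1 / 2) ^ (S.newLevel H w (S.newCover H w β) v + 1) * w v

/-- An iteration of the version of Algorithm MWHVC with at most one level increment of a vertex per
iteration. -/
noncomputable def MState.next (H : Hypergraph V) (w : V → ℝ) (β α : ℝ) (S : MState V) : MState V :=
  S.step H w β α (1 / 2)

@[simp] theorem MState.next_cover : (S.next H w β α).cover = S.newCover H w β := rfl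

@[simp] theorem MState.next_level :
    (S.next H w β α).level = S.newLevel H w (S.newCover H w β) := rfl

theorem MState.next_deal_of_raise (he : e ∈ H.uncovered (S.newCover H w β))
    (h : ∀ v ∈ e, S.Raises H w β α v) : (S.next H w β α).deal e = α * S.scaledDeal H w β e := by
  simp only [MState.next, MState.step]
  rw [if_pos he]
  exact if_pos h

theorem MState.next_deal_of_stuck (he : e ∈ H.uncovered (S.newCover H w β))
    (h : ¬ ∀ v ∈ e, S.Raises H w β α v) : (S.next H w β α).deal e = S.scaledDeal H w β e := by
  simp only [MState.next, MState.step]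
  rw [if_pos he]
  exact if_neg h

theorem MState.next_deal_of_covered (he : e ∉ H.uncovered (S.newCover H w β)) :
    (S.next H w β α).deal e = S.deal e := by
  simp only [MState.next, MState.step]
  rw [if_neg he]

theorem MState.next_dual (he : e ∈ H.uncovered (S.newCover H w β)) :
    (S.next H w β α).dual e = S.dual e + 1 / 2 * (S.next H w β α).deal e := by
  simp only [MState.next, MState.step]
  rw [if_pos he]

theorem MState.next_dual_of_covered (he : e ∉ H.uncovered (S.newCover H w β)) :
    (S.next H w β α).dual e = S.dual e := by
  simp only [MState.next, MState.step]
  rw [if_neg he]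

/-- The invariants that hold at the end of every iteration. -/
structure MState.Inv (H : Hypergraph V) (w : V → ℝ) (S : MState V) : Prop where
  deal_pos : ∀ e ∈ H.edges, 0 < S.deal e
  dual_nonneg : ∀ e ∈ H.edges, 0 ≤ S.dual e
  sum_deal_le : ∀ v, ∑ e ∈ H.uncoveredAt S.cover v, S.deal e ≤ (1 / 2) ^ (S.level v + 1) * w v
  load_le : ∀ v, S.load H v ≤ w v * (1 - (1 / 2) ^ (S.level v + 2))
  le_load : ∀ v, w v * (1 - (1 / 2) ^ S.level v) ≤ S.load H v

theorem MState.le_newLevel (hS : S.Inv H w) (C : Finset V) (v : V) :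
    S.level v ≤ S.newLevel H w C v := by
  unfold MState.newLevel
  split_ifs
  · exact (Nat.sInf_mem (s := {k : ℕ | S.level v ≤ k ∧ S.load H v ≤ w v * (1 - (1 / 2) ^ (k + 1))})
      ⟨S.level v + 1, by omega, hS.load_le v⟩).1
  · exact le_rfl

/-- The invariant `load_le` is the exit condition of the level loop for `level v + 1`, so the loop
runs at most once. -/
theorem MState.newLevel_le (hS : S.Inv H w) (C : Finset V) (v : V) :
    S.newLevel H w C v ≤ S.level v + 1 := by
  unfold MState.newLevel
  split_ifs
  · exact Nat.sInf_le ⟨by omega, hS.load_le v⟩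
  · omega

theorem MState.load_le_of_active (hS : S.Inv H w) {C : Finset V} (h : (H.uncoveredAt C v).Nonempty) :
    S.load H v ≤ w v * (1 - (1 / 2) ^ (S.newLevel H w C v + 1)) := by
  unfold MState.newLevel
  rw [if_pos h]
  exact (Nat.sInf_mem (s := {k : ℕ | S.level v ≤ k ∧ S.load H v ≤ w v * (1 - (1 / 2) ^ (k + 1))})
      ⟨S.level v + 1, by omega, hS.load_le v⟩).2

/-- If the level rises, the exit condition failed at the old level, and this failure is the required
lower bound at the new one. -/
theorem MState.le_load_newLevel (hS : S.Inv H w) (C : Finset V) (v : V) :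
    w v * (1 - (1 / 2) ^ S.newLevel H w C v) ≤ S.load H v := by
  by_cases h : S.newLevel H w C v = S.level v
  · rw [h]; exact hS.le_load v
  · have h1 := S.le_newLevel hS C v
    have h2 := S.newLevel_le hS C v
    have h3 : S.newLevel H w C v = S.level v + 1 := by omega
    rw [h3]
    by_contra hlt
    refine h (le_antisymm ?_ h1)
    unfold MState.newLevel
    split_ifs
    · exact Nat.sInf_le ⟨le_rfl, (not_le.1 hlt).le⟩
    · exact le_rfl

theorem MState.scaledDeal_pos (hS : S.Inv H w) (he : e ∈ H.edges) : 0 < S.scaledDeal H w β e :=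
  mul_pos (hS.deal_pos e he) (by positivity)

theorem MState.scaledDeal_le (hS : S.Inv H w) (he : e ∈ H.edges) (hv : v ∈ e) :
    S.scaledDeal H w β e
      ≤ S.deal e * (1 / 2) ^ (S.newLevel H w (S.newCover H w β) v - S.level v) := by
  refine mul_le_mul_of_nonneg_left ?_ (hS.deal_pos e he).le
  refine pow_le_pow_of_le_one (by norm_num) (by norm_num) ?_
  exact Finset.single_le_sum (f := fun v => S.newLevel H w (S.newCover H w β) v - S.level v)
    (fun _ _ => Nat.zero_le _) hv

theorem MState.next_deal_pos (hα : 2 ≤ α) (hS : S.Inv H w) (he : e ∈ H.edges) :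
    0 < (S.next H w β α).deal e := by
  by_cases hu : e ∈ H.uncovered (S.newCover H w β)
  · by_cases hr : ∀ v ∈ e, S.Raises H w β α v
    · rw [MState.next_deal_of_raise hu hr]
      exact mul_pos (by linarith) (MState.scaledDeal_pos hS he)
    · rw [MState.next_deal_of_stuck hu hr]
      exact MState.scaledDeal_pos hS he
  · rw [MState.next_deal_of_covered hu]
    exact hS.deal_pos e he

theorem MState.dual_le_next_dual (hα : 2 ≤ α) (hS : S.Inv H w) (he : e ∈ H.edges) :
    S.dual e ≤ (S.next H w β α).dual e := by
  by_cases hu : e ∈ H.uncovered (S.newCover H w β)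
  · rw [MState.next_dual hu]
    have := MState.next_deal_pos (β := β) hα hS he
    linarith
  · rw [MState.next_dual_of_covered hu]

theorem MState.load_le_next_load (hα : 2 ≤ α) (hS : S.Inv H w) (v : V) :
    S.load H v ≤ (S.next H w β α).load H v :=
  Finset.sum_le_sum fun _ he => MState.dual_le_next_dual hα hS (Hypergraph.mem_incident.1 he).1

theorem MState.next_load (S : MState V) (v : V) : (S.next H w β α).load H v
    = S.load H v + 1 / 2 * ∑ e ∈ H.uncoveredAt (S.newCover H w β) v, (S.next H w β α).deal e := by
  have h : ∀ e ∈ H.incident v, (S.next H w β α).dual e = S.dual e +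
      if e ∈ H.uncoveredAt (S.newCover H w β) v then 1 / 2 * (S.next H w β α).deal e else 0 := by
    intro e he
    have hv := (Hypergraph.mem_incident.1 he).2
    by_cases hu : e ∈ H.uncovered (S.newCover H w β)
    · rw [MState.next_dual hu, if_pos (Hypergraph.mem_uncoveredAt.2 ⟨hu, hv⟩)]
    · rw [MState.next_dual_of_covered hu, if_neg fun h => hu (Hypergraph.mem_uncoveredAt.1 h).1,
        add_zero]
  unfold MState.load
  rw [Finset.sum_congr rfl h, Finset.sum_add_distrib, ← Finset.sum_filter,
    Finset.filter_mem_eq_inter,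
    Finset.inter_eq_right.2 (Hypergraph.uncoveredAt_subset_incident _ _), Finset.mul_sum]

/-- Each increment of `v` halves both sides; increments of other vertices and newly covered
hyperedges only decrease the left side. -/
theorem MState.sum_scaledDeal_le (hS : S.Inv H w) (v : V) :
    ∑ e ∈ H.uncoveredAt (S.newCover H w β) v, S.scaledDeal H w β e
      ≤ (1 / 2) ^ (S.newLevel H w (S.newCover H w β) v + 1) * w v := by
  set C := S.newCover H w β with hC
  have h1 : ∑ e ∈ H.uncoveredAt C v, S.scaledDeal H w β e
      ≤ ∑ e ∈ H.uncoveredAt S.cover v, S.deal e * (1 / 2) ^ (S.newLevel H w C v - S.level v) := by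
    refine (Finset.sum_le_sum fun e he => ?_).trans (Finset.sum_le_sum_of_subset_of_nonneg
      (Hypergraph.uncoveredAt_anti MState.cover_subset_newCover v) fun e he _ => ?_)
    · have := Hypergraph.mem_incident.1 (Hypergraph.uncoveredAt_subset_incident _ _ he)
      exact MState.scaledDeal_le hS this.1 this.2
    · have := Hypergraph.mem_incident.1 (Hypergraph.uncoveredAt_subset_incident _ _ he)
      exact mul_nonneg (hS.deal_pos e this.1).le (by positivity)
  rw [← Finset.sum_mul] at h1
  refine h1.trans ((mul_le_mul_of_nonneg_right (hS.sum_deal_le v) (by positivity)).trans_eq ?_)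
  have h2 := S.le_newLevel hS C v
  rw [mul_right_comm, ← pow_add]
  congr 2
  omega

/-- If `v` raises, its test leaves room for a factor `α`; if it is stuck, none of its hyperedges is
multiplied. -/
theorem MState.sum_next_deal_le (hα : 2 ≤ α) (hS : S.Inv H w) (v : V) :
    ∑ e ∈ H.uncoveredAt (S.newCover H w β) v, (S.next H w β α).deal e
      ≤ (1 / 2) ^ (S.newLevel H w (S.newCover H w β) v + 1) * w v := by
  by_cases hr : S.Raises H w β α v
  · have h1 : ∑ e ∈ H.uncoveredAt (S.newCover H w β) v, (S.next H w β α).deal e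
        ≤ ∑ e ∈ H.uncoveredAt (S.newCover H w β) v, α * S.scaledDeal H w β e := by
      refine Finset.sum_le_sum fun e he => ?_
      have he' := Hypergraph.mem_uncoveredAt.1 he
      have hpos := MState.scaledDeal_pos (β := β) hS (Hypergraph.mem_uncovered.1 he'.1).1
      by_cases h : ∀ v ∈ e, S.Raises H w β α v
      · rw [MState.next_deal_of_raise he'.1 h]
      · rw [MState.next_deal_of_stuck he'.1 h]
        nlinarith
    rw [← Finset.mul_sum] at h1
    refine h1.trans ((mul_le_mul_of_nonneg_left hr (by linarith)).trans_eq ?_)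
    field_simp
  · refine le_trans (Finset.sum_le_sum fun e he => ?_) (MState.sum_scaledDeal_le hS v)
    have he' := Hypergraph.mem_uncoveredAt.1 he
    rw [MState.next_deal_of_stuck he'.1 fun h => hr (h v he'.2)]

theorem MState.Inv.next (hα : 2 ≤ α) (hS : S.Inv H w) : (S.next H w β α).Inv H w where
  deal_pos e he := MState.next_deal_pos hα hS he
  dual_nonneg e he := (hS.dual_nonneg e he).trans (MState.dual_le_next_dual hα hS he)
  sum_deal_le v := MState.sum_next_deal_le hα hS v
  load_le v := by
    rw [MState.next_load, MState.next_level]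
    by_cases h : (H.uncoveredAt (S.newCover H w β) v).Nonempty
    -- With `ℓ` the new level, the load was at most `w (1 - 2^(-ℓ-1))` and grows by half of a sum of
    -- at most `2^(-ℓ-1) w`. The factor `1 / 2` is what leaves a slack of `2^(-ℓ-2) w`.
    · have h1 := MState.sum_next_deal_le (β := β) hα hS v
      have h2 := MState.load_le_of_active hS h
      rw [pow_succ] at h1 h2
      rw [pow_add]
      nlinarith
    · rw [Finset.not_nonempty_iff_eq_empty.1 h, Finset.sum_empty, MState.newLevel, if_neg h]
      simpa using hS.load_le v
  le_load v := (S.le_load_newLevel hS _ v).trans (MState.load_le_next_load hα hS v)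

/-! ### The initial state, and the invariants in all iterations. -/

theorem MState.init_deal (he : e.Nonempty) : (MState.init H w).deal e
    = 1 / 2 * e.inf' he fun v => w v / ((H.incident v).card : ℝ) := by
  simp [MState.init, he]

theorem MState.init_dual : (MState.init H w).dual = (MState.init H w).deal := rfl

theorem MState.init_deal_le (hv : v ∈ e) :
    (MState.init H w).deal e ≤ 1 / 2 * (w v / ((H.incident v).card : ℝ)) := by
  rw [MState.init_deal ⟨v, hv⟩]
  exact mul_le_mul_of_nonneg_left (Finset.inf'_le _ hv) (by norm_num)

theorem Hypergraph.card_incident_pos (he : e ∈ H.edges) (hv : v ∈ e) : 0 < (H.incident v).card :=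
  Finset.card_pos.2 ⟨e, Hypergraph.mem_incident.2 ⟨he, hv⟩⟩

theorem MState.init_deal_pos (hw : ∀ v, 0 < w v) (he : e ∈ H.edges) :
    0 < (MState.init H w).deal e := by
  rw [MState.init_deal (H.nonempty_of_mem e he)]
  refine mul_pos (by norm_num) ((Finset.lt_inf'_iff _).2 fun v hv => ?_)
  exact div_pos (hw v) (by exact_mod_cast Hypergraph.card_incident_pos he hv)

theorem MState.init_load_le (hw : ∀ v, 0 < w v) (v : V) :
    ∑ e ∈ H.incident v, (MState.init H w).deal e ≤ 1 / 2 * w v := by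
  by_cases h : (H.incident v).card = 0
  · rw [Finset.card_eq_zero.1 h, Finset.sum_empty]
    exact mul_nonneg (by norm_num) (hw v).le
  · refine (Finset.sum_le_card_nsmul _ _ _ fun e he =>
      MState.init_deal_le (Hypergraph.mem_incident.1 he).2).trans_eq ?_
    rw [nsmul_eq_mul]
    have : ((H.incident v).card : ℝ) ≠ 0 := by exact_mod_cast h
    field_simp

theorem MState.Inv.init (hw : ∀ v, 0 < w v) : (MState.init H w).Inv H w where
  deal_pos e he := MState.init_deal_pos hw he
  dual_nonneg e he := (MState.init_deal_pos hw he).le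
  sum_deal_le v := by
    refine (Finset.sum_le_sum_of_subset_of_nonneg (Hypergraph.uncoveredAt_subset_incident _ v)
      fun e he _ => (MState.init_deal_pos hw (Hypergraph.mem_incident.1 he).1).le).trans ?_
    simpa [MState.init] using MState.init_load_le (H := H) hw v
  load_le v := by
    have h := MState.init_load_le (H := H) hw v
    have h2 : (MState.init H w).level v = 0 := rfl
    rw [h2, MState.load, MState.init_dual]
    refine h.trans ?_
    nlinarith [hw v]
  le_load v := by
    have h : w v * (1 - (1 / 2) ^ (MState.init H w).level v) = 0 := by simp [MState.init]
    rw [h]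
    exact Finset.sum_nonneg fun e he =>
      (MState.init_deal_pos hw (Hypergraph.mem_incident.1 he).1).le

theorem MState.after_succ (i : ℕ) : MState.after H w β α (1 / 2) (i + 1)
    = (MState.after H w β α (1 / 2) i).next H w β α := by
  simp only [MState.after, Function.iterate_succ_apply', MState.next]

theorem MState.Inv.after (hα : 2 ≤ α) (hw : ∀ v, 0 < w v) (i : ℕ) :
    (MState.after H w β α (1 / 2) i).Inv H w := by
  induction i with
  | zero => exact MState.Inv.init hw
  | succ i ih => rw [MState.after_succ]; exact ih.next hα

theorem MState.after_cover_mono {i j : ℕ} (hij : i ≤ j) :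
    (MState.after H w β α (1 / 2) i).cover ⊆ (MState.after H w β α (1 / 2) j).cover := by
  induction j, hij using Nat.le_induction with
  | base => exact subset_rfl
  | succ j _ ih => rw [MState.after_succ]; exact ih.trans MState.cover_subset_newCover

/-! ### The approximation ratio -/

/-- Tightness holds when the vertex joins and persists because loads never decrease. -/
theorem MState.load_of_mem_cover (hα : 2 ≤ α) (hw : ∀ v, 0 < w v) (i : ℕ) {v : V}
    (hv : v ∈ (MState.after H w β α (1 / 2) i).cover) :
    (1 - β) * w v ≤ (MState.after H w β α (1 / 2) i).load H v ∧ (H.incident v).Nonempty := by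
  induction i with
  | zero => simp [MState.after, MState.init] at hv
  | succ i ih =>
    rw [MState.after_succ] at hv ⊢
    have hinv := MState.Inv.after (H := H) (β := β) hα hw i
    rcases MState.mem_newCover.1 hv with h | h
    · exact ⟨(ih h).1.trans (MState.load_le_next_load hα hinv v), (ih h).2⟩
    · exact ⟨h.2.trans (MState.load_le_next_load hα hinv v),
        h.1.mono (Hypergraph.uncoveredAt_subset_incident _ _)⟩

theorem MState.load_le_weight (hS : S.Inv H w) (hw : ∀ v, 0 < w v) (v : V) : S.load H v ≤ w v := by
  refine (hS.load_le v).trans ?_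
  have : (0 : ℝ) < (1 / 2) ^ (S.level v + 2) := by positivity
  nlinarith [hw v]

/-- The cover computed by Algorithm MWHVC is an `(f + ε)`-approximation. -/
theorem MState.sum_cover_le {f : ℕ} {ε : ℝ} (hε : 0 < ε) (hf : H.RankLE f) (hf0 : 0 < f)
    (hα : 2 ≤ α) (hw : ∀ v, 0 < w v) (i : ℕ) {Y : Finset V}
    (hY : ∀ e ∈ H.edges, ∃ v ∈ e, v ∈ Y) :
    ∑ v ∈ (MState.after H w (ε / (f + ε)) α (1 / 2) i).cover, w v ≤ (f + ε) * ∑ v ∈ Y, w v := by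
  set S := MState.after H w (ε / (f + ε)) α (1 / 2) i with hS
  have hinv : S.Inv H w := MState.Inv.after hα hw i
  have hf' : (0 : ℝ) < f := by exact_mod_cast hf0
  have hβ : 1 - ε / (f + ε) = f / (f + ε) := by field_simp; ring
  have h1 : ∀ v ∈ S.cover, f / (f + ε) * w v ≤ S.load H v := fun v hv =>
    hβ ▸ (MState.load_of_mem_cover hα hw i hv).1
  -- Double counting, used twice: for the cover each dual counts at most `f` times, and for the
  -- competitor `Y` at least once.
  have hswap : ∀ Z : Finset V, ∑ v ∈ Z, S.load H v = ∑ e ∈ H.edges, ((Z ∩ e).card : ℝ) * S.dual e := by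
    intro Z
    simp only [MState.load, Hypergraph.incident, Finset.sum_filter]
    rw [Finset.sum_comm]
    refine Finset.sum_congr rfl fun e _ => ?_
    rw [← Finset.sum_filter, Finset.sum_const, nsmul_eq_mul, Finset.filter_mem_eq_inter]
  have h2 : ∑ v ∈ S.cover, S.load H v ≤ f * ∑ e ∈ H.edges, S.dual e := by
    rw [hswap, Finset.mul_sum]
    refine Finset.sum_le_sum fun e he => mul_le_mul_of_nonneg_right ?_ (hinv.dual_nonneg e he)
    exact_mod_cast (Finset.card_le_card Finset.inter_subset_right).trans (hf e he)
  have h3 : ∑ e ∈ H.edges, S.dual e ≤ ∑ v ∈ Y, w v := by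
    refine le_trans ?_ (Finset.sum_le_sum fun v _ => MState.load_le_weight hinv hw v)
    rw [hswap]
    refine Finset.sum_le_sum fun e he => ?_
    obtain ⟨v, hv, hvY⟩ := hY e he
    have hc : (1 : ℝ) ≤ ((Y ∩ e).card : ℝ) := by
      exact_mod_cast Finset.card_pos.2 ⟨v, Finset.mem_inter.2 ⟨hvY, hv⟩⟩
    exact le_mul_of_one_le_left (hinv.dual_nonneg e he) hc
  have h4 : f / (f + ε) * ∑ v ∈ S.cover, w v ≤ f * ∑ v ∈ Y, w v := by
    rw [Finset.mul_sum]
    exact (Finset.sum_le_sum h1).trans (h2.trans (mul_le_mul_of_nonneg_left h3 hf'.le))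
  rw [div_mul_eq_mul_div, div_le_iff₀ (by positivity)] at h4
  nlinarith

end Invariants

/-! ## Termination of Algorithm MWHVC -/

section Termination

variable {V : Type} [Fintype V] [DecidableEq V] {H : Hypergraph V} {w : V → ℝ} {β α : ℝ}
  {S : MState V} {v : V} {e : Finset V}

theorem MState.load_lt_weight (hS : S.Inv H w) (hw : ∀ v, 0 < w v) (v : V) : S.load H v < w v := by
  refine (hS.load_le v).trans_lt ?_
  have : (0 : ℝ) < (1 / 2) ^ (S.level v + 2) := by positivity
  nlinarith [hw v]

/-- The deal of `e`, had its vertices stayed at level `0`. -/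
noncomputable def MState.baseDeal (S : MState V) (e : Finset V) : ℝ :=
  S.deal e * 2 ^ ∑ v ∈ e, S.level v

/-- Undoing the halvings makes the base deal insensitive to level increments, so it changes only
when all vertices of `e` raise. -/
theorem MState.scaledDeal_mul (hS : S.Inv H w) (e : Finset V) :
    S.scaledDeal H w β e * 2 ^ ∑ v ∈ e, S.newLevel H w (S.newCover H w β) v = S.baseDeal e := by
  have h : ∑ v ∈ e, S.newLevel H w (S.newCover H w β) v
      = ∑ v ∈ e, (S.newLevel H w (S.newCover H w β) v - S.level v) + ∑ v ∈ e, S.level v := by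
    rw [← Finset.sum_add_distrib]
    refine Finset.sum_congr rfl fun v _ => ?_
    have := S.le_newLevel hS (S.newCover H w β) v
    omega
  rw [MState.scaledDeal, MState.baseDeal, h, pow_add, one_div, inv_pow]
  field_simp

theorem MState.baseDeal_pos (hS : S.Inv H w) (he : e ∈ H.edges) : 0 < S.baseDeal e :=
  mul_pos (hS.deal_pos e he) (by positivity)

/-- A potential that increases by at least `1` in each iteration in which `e` remains uncovered. -/
noncomputable def MState.potential (H : Hypergraph V) (w : V → ℝ) (α : ℝ) (S : MState V)
    (e : Finset V) : ℝ :=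
  Real.log (S.baseDeal e) / Real.log α - 4 * α * ∑ v ∈ e, Real.log (w v - S.load H v)

theorem MState.scaledDeal_le_next_deal (hα : 2 ≤ α) (hS : S.Inv H w)
    (he : e ∈ H.uncovered (S.newCover H w β)) :
    S.scaledDeal H w β e ≤ (S.next H w β α).deal e := by
  have hpos := MState.scaledDeal_pos (β := β) hS (Hypergraph.mem_uncovered.1 he).1
  by_cases h : ∀ v ∈ e, S.Raises H w β α v
  · rw [MState.next_deal_of_raise he h]
    nlinarith
  · rw [MState.next_deal_of_stuck he h]

/-- With `ℓ` the new level, a stuck vertex has deals of more than `2^(-ℓ-1) w / α`, half of which is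
added to its load. Its slack was at most `2^(-ℓ) w`, so at least a fraction `1 / (4 α)` of it
disappears. -/
theorem MState.slack_next_le_of_stuck (hα : 2 ≤ α) (hS : S.Inv H w)
    (h : ¬ S.Raises H w β α v) :
    w v - (S.next H w β α).load H v ≤ (w v - S.load H v) * (1 - 1 / (4 * α)) := by
  have h1 := S.le_load_newLevel hS (S.newCover H w β) v
  have h2 : ∑ e ∈ H.uncoveredAt (S.newCover H w β) v, S.scaledDeal H w β e
      ≤ ∑ e ∈ H.uncoveredAt (S.newCover H w β) v, (S.next H w β α).deal e :=
    Finset.sum_le_sum fun e he =>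
      MState.scaledDeal_le_next_deal hα hS (Hypergraph.mem_uncoveredAt.1 he).1
  rw [MState.Raises, not_le] at h
  rw [MState.next_load]
  set p : ℝ := (1 / 2) ^ S.newLevel H w (S.newCover H w β) v with hp
  rw [pow_succ, ← hp] at h
  have h3 : (w v - S.load H v) * (1 / (4 * α)) ≤ w v * p * (1 / (4 * α)) :=
    mul_le_mul_of_nonneg_right (by linarith) (by positivity)
  have h4 : w v * p * (1 / (4 * α)) = 1 / 2 * (1 / α * (p * (1 / 2)) * w v) := by
    field_simp
    norm_num
  linarith

/-- If all vertices of `e` raise, the base deal gains a factor `α`. Otherwise some vertex is stuck,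
the logarithm of its slack drops by at least `1 / (4 α)`, and no other slack grows. -/
theorem MState.potential_add_one_le (hα : 2 ≤ α) (hw : ∀ v, 0 < w v) (hS : S.Inv H w)
    (he : e ∈ H.uncovered (S.newCover H w β)) :
    S.potential H w α e + 1 ≤ (S.next H w β α).potential H w α e := by
  have hedge := (Hypergraph.mem_uncovered.1 he).1
  have hS' : (S.next H w β α).Inv H w := hS.next hα
  have hlogα : 0 < Real.log α := Real.log_pos (by linarith)
  have hbase := MState.baseDeal_pos hS hedge
  have hlog : ∀ v ∈ e, Real.log (w v - (S.next H w β α).load H v)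
      ≤ Real.log (w v - S.load H v) := fun v _ =>
    Real.log_le_log (by linarith [MState.load_lt_weight hS' hw v])
      (by linarith [MState.load_le_next_load (β := β) hα hS v])
  by_cases h : ∀ v ∈ e, S.Raises H w β α v
  · have h1 : (S.next H w β α).baseDeal e = α * S.baseDeal e := by
      rw [MState.baseDeal, MState.next_deal_of_raise he h, MState.next_level,
        ← MState.scaledDeal_mul (β := β) hS e]
      ring
    have h2 := Finset.sum_le_sum hlog
    rw [MState.potential, MState.potential, h1, Real.log_mul (by linarith) hbase.ne', add_div,
      div_self hlogα.ne']
    nlinarith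
  · have h1 : (S.next H w β α).baseDeal e = S.baseDeal e := by
      rw [MState.baseDeal, MState.next_deal_of_stuck he h, MState.next_level,
        MState.scaledDeal_mul hS e]
    push Not at h
    obtain ⟨u, hu, hstuck⟩ := h
    have h3 : Real.log (w u - (S.next H w β α).load H u)
        ≤ Real.log (w u - S.load H u) - 1 / (4 * α) := by
      have hs := MState.load_lt_weight hS hw u
      have hfrac : 1 / (4 * α) < 1 := by rw [div_lt_one (by linarith)]; linarith
      refine (Real.log_le_log (by linarith [MState.load_lt_weight hS' hw u])
        (MState.slack_next_le_of_stuck hα hS hstuck)).trans ?_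
      rw [Real.log_mul (by linarith) (by linarith)]
      linarith [Real.log_le_sub_one_of_pos (show 0 < 1 - 1 / (4 * α) by linarith)]
    have h4 : ∑ v ∈ e, Real.log (w v - (S.next H w β α).load H v)
        ≤ ∑ v ∈ e, Real.log (w v - S.load H v) - 1 / (4 * α) := by
      rw [← Finset.add_sum_erase e _ hu, ← Finset.add_sum_erase e _ hu]
      have := Finset.sum_le_sum fun v (hv : v ∈ e.erase u) => hlog v (Finset.mem_of_mem_erase hv)
      linarith
    rw [MState.potential, MState.potential, h1]
    have h5 := mul_le_mul_of_nonneg_left h4 (show 0 ≤ 4 * α by linarith)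
    rw [mul_sub, mul_one_div_cancel (by positivity)] at h5
    linarith

theorem MState.potential_init_add_le (hα : 2 ≤ α) (hw : ∀ v, 0 < w v) {i : ℕ}
    (he : e ∈ H.uncovered (MState.after H w β α (1 / 2) i).cover) :
    (MState.init H w).potential H w α e + i
      ≤ (MState.after H w β α (1 / 2) i).potential H w α e := by
  induction i with
  | zero => simp [MState.after]
  | succ i ih =>
    have h1 := ih (Hypergraph.uncovered_anti (MState.after_cover_mono (Nat.le_succ i)) he)
    rw [MState.after_succ] at he ⊢
    have h2 := MState.potential_add_one_le hα hw (MState.Inv.after hα hw i) he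
    push_cast
    linarith

/-- The number of iterations in which a hyperedge remains uncovered. -/
theorem MState.iteration_le {f D : ℕ} (hα : 2 ≤ α) (hw : ∀ v, 0 < w v) (hβ : 0 < β) (hβ1 : β ≤ 1)
    (hf : H.RankLE f) (hD : H.DegreeLE D) {i : ℕ}
    (he : e ∈ H.uncovered (MState.after H w β α (1 / 2) (i + 1)).cover) :
    (i : ℝ) ≤ (Real.log D + f * Real.log (1 / β)) / Real.log α
      + 4 * α * (f * Real.log (1 / β)) := by
  have hei := Hypergraph.uncovered_anti (MState.after_cover_mono (Nat.le_succ i)) he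
  have hedge := (Hypergraph.mem_uncovered.1 he).1
  have hpot := MState.potential_init_add_le hα hw hei
  set S := MState.after H w β α (1 / 2) i with hSdef
  have hS : S.Inv H w := MState.Inv.after hα hw i
  have hlogα : 0 < Real.log α := Real.log_pos (by linarith)
  have hlogβ : 0 ≤ Real.log (1 / β) := Real.log_nonneg (by rw [le_div_iff₀ hβ]; linarith)
  have hcard : (e.card : ℝ) * Real.log (1 / β) ≤ f * Real.log (1 / β) :=
    mul_le_mul_of_nonneg_right (by exact_mod_cast hf e hedge) hlogβ
  -- the slack of the vertices of `e`
  have hslack : ∀ v ∈ e, β * w v < w v - S.load H v := by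
    intro v hv
    rw [MState.after_succ, MState.next_cover] at he
    -- The tightness test of iteration `i + 1` reads the loads at the end of iteration `i`; hence
    -- the bound is on `i` although `e` survives iteration `i + 1`.
    have hnot : v ∉ S.newCover H w β := fun h =>
      Finset.disjoint_left.1 (Hypergraph.mem_uncovered.1 he).2 hv h
    rw [MState.mem_newCover] at hnot
    push Not at hnot
    have := hnot.2 ⟨e, Hypergraph.mem_uncoveredAt.2 ⟨hei, hv⟩⟩
    linarith
  have hslack0 : ∀ v ∈ e, Real.log (w v - (MState.init H w).load H v)
      - Real.log (w v - S.load H v) ≤ Real.log (1 / β) := by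
    intro v hv
    have h0 := MState.load_lt_weight (MState.Inv.init (H := H) hw) hw v
    have h1 : 0 ≤ (MState.init H w).load H v :=
      Finset.sum_nonneg fun e he => (MState.Inv.init hw).dual_nonneg e (Hypergraph.mem_incident.1 he).1
    have h2 := hslack v hv
    have h3 := mul_pos hβ (hw v)
    rw [← Real.log_div (by linarith) (by linarith)]
    refine Real.log_le_log (div_pos (by linarith) (by linarith)) ?_
    rw [div_le_div_iff₀ (by linarith) hβ]
    nlinarith
  have hsum : ∑ v ∈ e, Real.log (w v - (MState.init H w).load H v)
      - ∑ v ∈ e, Real.log (w v - S.load H v) ≤ f * Real.log (1 / β) := by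
    rw [← Finset.sum_sub_distrib]
    refine (Finset.sum_le_card_nsmul _ _ _ hslack0).trans ?_
    rwa [nsmul_eq_mul]
  -- the deal of `e`
  have hlevel : ∀ v ∈ e, (S.level v : ℝ) * Real.log 2 ≤ Real.log (1 / β) := by
    intro v hv
    have h1 := hS.le_load v
    have h2 := hslack v hv
    -- The slack exceeds `β w` and is at most `2^(-ℓ) w`, which bounds the level `ℓ`.
    have h3 : β * w v < (1 / 2) ^ S.level v * w v := by nlinarith
    have h4 := lt_of_mul_lt_mul_right h3 (hw v).le
    rw [← Real.log_pow]
    refine Real.log_le_log (by positivity) ?_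
    rw [le_div_iff₀ hβ]
    rw [one_div, inv_pow] at h4
    have h5 := mul_lt_mul_of_pos_left h4 (show (0 : ℝ) < 2 ^ S.level v by positivity)
    rw [mul_inv_cancel₀ (by positivity)] at h5
    exact h5.le
  have hbase : Real.log (S.baseDeal e) - Real.log ((MState.init H w).baseDeal e)
      ≤ Real.log D + f * Real.log (1 / β) := by
    -- For the vertex `u` that determines the initial deal, this deal is at least `w u / (2 D)`,
    -- while every later one is at most `w u / 2`. The deal itself therefore grows at most by a
    -- factor `D`.
    obtain ⟨u, hu, hmin⟩ := Finset.exists_mem_eq_inf' (H.nonempty_of_mem e hedge)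
      fun v => w v / ((H.incident v).card : ℝ)
    have hpos : (0 : ℝ) < (H.incident u).card := by
      exact_mod_cast Hypergraph.card_incident_pos hedge hu
    have hdeg : ((H.incident u).card : ℝ) ≤ D := by exact_mod_cast hD u
    have h0 : (MState.init H w).baseDeal e = 1 / 2 * (w u / (H.incident u).card) := by
      rw [MState.baseDeal, MState.init_deal (H.nonempty_of_mem e hedge), hmin]
      simp [MState.init]
    have h1 : S.deal e ≤ 1 / 2 * w u := by
      refine (Finset.single_le_sum (f := S.deal) (fun e he => (hS.deal_pos e
        (Hypergraph.mem_incident.1 (Hypergraph.uncoveredAt_subset_incident _ _ he)).1).le)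
        (Hypergraph.mem_uncoveredAt.2 ⟨hei, hu⟩)).trans ((hS.sum_deal_le u).trans ?_)
      refine mul_le_mul_of_nonneg_right ?_ (hw u).le
      exact pow_le_of_le_one (by norm_num) (by norm_num) (by omega)
    have h2 : Real.log (2 ^ ∑ v ∈ e, S.level v) ≤ f * Real.log (1 / β) := by
      rw [Real.log_pow, Nat.cast_sum, Finset.sum_mul]
      refine (Finset.sum_le_card_nsmul _ _ _ hlevel).trans ?_
      rwa [nsmul_eq_mul]
    have hdeal := hS.deal_pos e hedge
    have h3 : Real.log (S.deal e) ≤ Real.log D + Real.log (1 / 2 * (w u / (H.incident u).card)) := by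
      have hwu := hw u
      rw [← Real.log_mul (by linarith) (by positivity)]
      refine Real.log_le_log hdeal (h1.trans ?_)
      rw [← mul_div_assoc, ← mul_div_assoc, le_div_iff₀ hpos]
      nlinarith
    rw [h0, MState.baseDeal, Real.log_mul hdeal.ne' (by positivity)]
    linarith
  have h1 := div_le_div_of_nonneg_right hbase hlogα.le
  rw [sub_div] at h1
  have h2 := mul_le_mul_of_nonneg_left hsum (show 0 ≤ 4 * α by linarith)
  rw [MState.potential, MState.potential] at hpot
  linarith

end Termination

theorem two_le_multiplier (γ : ℝ) (f D : ℕ) (ε : ℝ) : 2 ≤ multiplier γ f D ε := by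
  unfold multiplier
  simp only
  split_ifs
  · exact le_max_left _ _
  · exact le_rfl

/-- The iteration bound of Algorithm MWHVC. -/
noncomputable def iterationBound (γ : ℝ) (f D : ℕ) (ε : ℝ) : ℝ :=
  (Real.log D + f * Real.log ((f + ε) / ε)) / Real.log (multiplier γ f D ε)
    + 4 * multiplier γ f D ε * (f * Real.log ((f + ε) / ε))

theorem mwhvcRounds_le (γ : ℝ) (f D : ℕ) {ε : ℝ} (hε : 0 < ε) :
    mwhvcRounds γ f D ε ≤ ((2 + 4 * (⌊iterationBound γ f D ε⌋₊ + 2) : ℕ) : ℕ∞) := by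
  refine iSup_le fun k => iSup_le fun H => iSup_le fun w => iSup_le fun h => ?_
  obtain ⟨hf, hD, hw⟩ := h
  -- A hyperedge surviving this iteration would give `⌊iterationBound⌋ + 1 ≤ iterationBound`.
  refine iInf_le_of_le (⌊iterationBound γ f D ε⌋₊ + 2) (iInf_le_of_le ?_ le_rfl)
  by_contra hne
  obtain ⟨e, he⟩ := Finset.nonempty_iff_ne_empty.2 hne
  have hf0 : (0 : ℝ) ≤ f := Nat.cast_nonneg f
  have h1 := MState.iteration_le (two_le_multiplier γ f D ε) hw (by positivity)
    (by rw [div_le_one (by positivity)]; linarith) hf hD he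
  rw [one_div_div] at h1
  have h2 := Nat.lt_floor_add_one (iterationBound γ f D ε)
  unfold iterationBound at h1 h2
  push_cast at h1
  linarith

/-! ## The closed expression -/

section ClosedBound

variable {γ ε : ℝ} {f D : ℕ}

theorem one_lt_log_of_four_le (hD : 4 ≤ D) : 1.38 < Real.log D := by
  have h1 : Real.log 4 ≤ Real.log D := Real.log_le_log (by norm_num) (by exact_mod_cast hD)
  have h2 : Real.log 4 = 2 * Real.log 2 := by
    rw [show (4 : ℝ) = 2 ^ 2 by norm_num, Real.log_pow]; norm_num
  have := Real.log_two_gt_d9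
  linarith

theorem log_log_gt_of_four_le (hD : 4 ≤ D) : 0.27 < Real.log (Real.log D) := by
  have h1 := one_lt_log_of_four_le hD
  have h2 := Real.one_sub_inv_le_log_of_pos (show 0 < Real.log D by linarith)
  have h3 : (Real.log D)⁻¹ ≤ (1.38 : ℝ)⁻¹ := inv_anti₀ (by norm_num) h1.le
  norm_num at h3 ⊢
  linarith

theorem two_le_div_of_le_one (hf : 2 ≤ f) (hε : 0 < ε) (hε1 : ε ≤ 1) : 2 ≤ (f : ℝ) / ε := by
  have hf' : (2 : ℝ) ≤ f := by exact_mod_cast hf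
  rw [le_div_iff₀ hε]
  linarith

theorem log_two_le_log_div (hf : 2 ≤ f) (hε : 0 < ε) (hε1 : ε ≤ 1) :
    Real.log 2 ≤ Real.log (f / ε) :=
  Real.log_le_log (by norm_num) (two_le_div_of_le_one hf hε hε1)

theorem one_lt_mul_log (hf : 2 ≤ f) (hε : 0 < ε) (hε1 : ε ≤ 1) : 1 < f * Real.log (f / ε) := by
  have h1 := log_two_le_log_div hf hε hε1
  have hf' : (2 : ℝ) ≤ f := by exact_mod_cast hf
  have := Real.log_two_gt_d9
  nlinarith

theorem log_add_div_le (hf : 2 ≤ f) (hε : 0 < ε) (hε1 : ε ≤ 1) :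
    Real.log ((f + ε) / ε) ≤ 2 * Real.log (f / ε) := by
  have h := two_le_div_of_le_one hf hε hε1
  have h1 : (2 : ℝ) * Real.log (f / ε) = Real.log ((f / ε) ^ 2) := by
    rw [Real.log_pow]; norm_num
  rw [h1, add_div, div_self hε.ne']
  exact Real.log_le_log (by linarith) (by nlinarith)

/-- Write `X = log D` and `G = f log (f / ε)`. If `α = max 2 q`, then `log α` is at least `γ / 2 *
log X`, and `α G ≤ 2 G + X / log X` because `q G = X / log X`. If `α = 2`, the bound is `O(X + G)`,
and smallness of `q` shows that `X` is within a constant factor of the minimum. -/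
theorem iterationBound_le_closedBound (hγ : 0 < γ) (hf : 2 ≤ f) (hD : 4 ≤ D) (hε : 0 < ε)
    (hε1 : ε ≤ 1) : iterationBound γ f D ε ≤ (21 + 4 / γ) * closedBound γ f D ε := by
  have hX := one_lt_log_of_four_le hD
  have hlX := log_log_gt_of_four_le hD
  have hG := one_lt_mul_log hf hε hε1
  have hL : (f : ℝ) * Real.log ((f + ε) / ε) ≤ 2 * (f * Real.log (f / ε)) := by
    have := mul_le_mul_of_nonneg_left (log_add_div_le hf hε hε1) (Nat.cast_nonneg (α := ℝ) f)
    linarith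
  have hα2 := two_le_multiplier γ f D ε
  have hlog2 := Real.log_two_gt_d9
  have hlα2 : Real.log 2 ≤ Real.log (multiplier γ f D ε) := Real.log_le_log (by norm_num) hα2
  have hγ' : 0 < 4 / γ := by positivity
  have hib : iterationBound γ f D ε ≤ (Real.log D + 2 * (f * Real.log (f / ε)))
      / Real.log (multiplier γ f D ε) + 8 * (multiplier γ f D ε * (f * Real.log (f / ε))) := by
    unfold iterationBound
    refine add_le_add (div_le_div_of_nonneg_right (by linarith) (by linarith)) ?_
    nlinarith
  refine hib.trans ?_
  clear hib hL
  unfold closedBound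
  have hGl : 2 * (f * Real.log (f / ε)) / Real.log (multiplier γ f D ε)
      ≤ 3 * (f * Real.log (f / ε)) := by
    rw [div_le_iff₀ (by linarith)]
    nlinarith
  have hα : multiplier γ f D ε = if Real.log D ^ (γ / 2)
      ≤ Real.log D / (f * Real.log (f / ε) * Real.log (Real.log D))
      then max 2 (Real.log D / (f * Real.log (f / ε) * Real.log (Real.log D))) else 2 := rfl
  set X := Real.log D with hXdef
  set G := (f : ℝ) * Real.log (f / ε) with hGdef
  set α := multiplier γ f D ε with hαdef
  have hXG : 0 < X / Real.log X := div_pos (by linarith) (by linarith)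
  have hXγ : 0 < X ^ γ := Real.rpow_pos_of_pos (by linarith) γ
  have hmin0 : 0 ≤ min X (G * X ^ γ) := le_min (by linarith) (by positivity)
  rw [add_div]
  split_ifs at hα with hq
  · -- `α = max 2 q`
    have hqpos : 0 < X ^ (γ / 2) := Real.rpow_pos_of_pos (by linarith) _
    have h1 : γ / 2 * Real.log X ≤ Real.log α := by
      rw [← Real.log_rpow (by linarith), hα]
      exact Real.log_le_log hqpos (hq.trans (le_max_right _ _))
    have h2 : X / Real.log α ≤ 4 / γ * (X / Real.log X) := by
      have h3 : X / Real.log α ≤ X / (γ / 2 * Real.log X) :=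
        div_le_div_of_nonneg_left (by linarith) (by positivity) h1
      have h4 : X / (γ / 2 * Real.log X) = 2 / γ * (X / Real.log X) := by
        field_simp
      have h5 : 2 / γ ≤ 4 / γ := div_le_div_of_nonneg_right (by norm_num) hγ.le
      nlinarith
    have h3 : α * G ≤ 2 * G + X / Real.log X := by
      have h4 : X / (G * Real.log X) * G = X / Real.log X := by
        field_simp
      rw [← h4, ← add_mul, hα]
      refine mul_le_mul_of_nonneg_right (max_le ?_ ?_) (by linarith)
      · have : 0 < X / (G * Real.log X) := div_pos (by linarith) (by positivity)
        linarith
      · linarith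
    nlinarith
  -- Here `X < X ^ (γ / 2) * G * log X`, and `log X ≤ (2 / γ) X ^ (γ / 2)` supplies the other half
  -- of the power.
  · have h1 : X ≤ (1 + 2 / γ) * min X (G * X ^ γ) := by
      have h2 : Real.log X ≤ X ^ (γ / 2) / (γ / 2) :=
        Real.log_le_rpow_div (by linarith) (by positivity)
      rw [not_le, div_lt_iff₀ (by positivity)] at hq
      have h3 : X ^ (γ / 2) * X ^ (γ / 2) = X ^ γ := by
        rw [← Real.rpow_add (by linarith), add_halves]
      have hqpos : 0 < X ^ (γ / 2) := Real.rpow_pos_of_pos (by linarith) _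
      have h4 : X ≤ 2 / γ * (G * X ^ γ) := by
        refine hq.le.trans ?_
        have h5 := mul_le_mul_of_nonneg_left h2 (show 0 ≤ X ^ (γ / 2) * G by positivity)
        have h6 : X ^ (γ / 2) * G * (X ^ (γ / 2) / (γ / 2)) = 2 / γ * (G * X ^ γ) := by
          rw [← h3]
          field_simp
        linarith
      have h7 : 0 < 2 / γ := by positivity
      rcases min_choice X (G * X ^ γ) with h | h <;> rw [h]
      · nlinarith
      · nlinarith [mul_pos (show 0 < G by linarith) hXγ]
    have h2 : X / Real.log α ≤ 2 * X := by
      rw [div_le_iff₀ (by linarith)]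
      nlinarith
    have h3 : 2 * ((1 + 2 / γ) * min X (G * X ^ γ)) = (2 + 4 / γ) * min X (G * X ^ γ) := by ring
    rw [hα] at h2 hGl ⊢
    nlinarith

theorem one_le_closedBound (hf : 2 ≤ f) (hD : 4 ≤ D) (hε : 0 < ε) (hε1 : ε ≤ 1) :
    1 ≤ closedBound γ f D ε := by
  have hX := one_lt_log_of_four_le hD
  have hlX := log_log_gt_of_four_le hD
  have hG := one_lt_mul_log hf hε hε1
  have h1 : 0 < Real.log D / Real.log (Real.log D) := div_pos (by linarith) (by linarith)
  have h2 : 0 ≤ min (Real.log D) (f * Real.log (f / ε) * Real.log D ^ γ) :=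
    le_min (by linarith) (mul_nonneg (by linarith) (Real.rpow_nonneg (by linarith) _))
  unfold closedBound
  linarith

/-- For `f = ε = 1` the term `f log (f / ε)` vanishes, so the bound rests on `log x ≤ x - 1` at `x =
log D`. -/
theorem one_le_closedBound_of_rank_one (hD : 3 ≤ D) (hε : 0 < ε) (hε1 : ε ≤ 1) :
    1 ≤ closedBound γ 1 D ε := by
  have hX : 1 < Real.log D := by
    rw [Real.lt_log_iff_exp_lt (by positivity)]
    have : (3 : ℝ) ≤ D := by exact_mod_cast hD
    linarith [Real.exp_one_lt_d9]
  have hlX := Real.log_pos hX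
  have hG : 0 ≤ Real.log (1 / ε) := Real.log_nonneg (by rw [le_div_iff₀ hε]; linarith)
  have h1 : 1 ≤ Real.log D / Real.log (Real.log D) := by
    rw [le_div_iff₀ hlX]
    linarith [Real.log_le_sub_one_of_pos (show 0 < Real.log D by linarith)]
  have h2 : 0 ≤ min (Real.log D) (Real.log (1 / ε) * Real.log D ^ γ) :=
    le_min (by linarith) (mul_nonneg hG (Real.rpow_nonneg (by linarith) _))
  unfold closedBound
  simp only [Nat.cast_one, one_mul]
  linarith

/-- The number of rounds of Algorithm MWHVC is finite and bounded by the closed expression. -/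
theorem exists_mwhvcRounds_eq (hγ : 0 < γ) (hf : 2 ≤ f) (hD : 4 ≤ D) (hε : 0 < ε) (hε1 : ε ≤ 1) :
    ∃ T : ℕ, mwhvcRounds γ f D ε = T ∧ (T : ℝ) ≤ (94 + 16 / γ) * closedBound γ f D ε := by
  have h := mwhvcRounds_le γ f D hε
  obtain ⟨T, hT⟩ := ENat.ne_top_iff_exists.1 (ne_top_of_le_ne_top (ENat.natCast_ne_top _) h)
  refine ⟨T, hT.symm, ?_⟩
  rw [← hT, Nat.cast_le] at h
  have hcb := one_le_closedBound (γ := γ) hf hD hε hε1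
  have hib := iterationBound_le_closedBound hγ hf hD hε hε1
  have hγ' : 0 < 4 / γ := by positivity
  have h16 : 16 / γ = 4 * (4 / γ) := by ring
  have h1 : (⌊iterationBound γ f D ε⌋₊ : ℝ) ≤ (21 + 4 / γ) * closedBound γ f D ε := by
    rcases le_total 0 (iterationBound γ f D ε) with h0 | h0
    · exact (Nat.floor_le h0).trans hib
    · rw [Nat.floor_of_nonpos h0, Nat.cast_zero]
      positivity
  -- This is `10` plus four times the floor, whence `94 = 10 + 4 * 21` and `16 / γ = 4 * (4 / γ)`.
  have h2 : (T : ℝ) ≤ 2 + 4 * (⌊iterationBound γ f D ε⌋₊ + 2) := by exact_mod_cast h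
  rw [h16]
  nlinarith

end ClosedBound

/-! ## A lower bound on the number of rounds of Algorithm MWHVC -/

section LowerBound

variable {V : Type} [Fintype V] [DecidableEq V] {H : Hypergraph V} {w : V → ℝ} {β α : ℝ}

theorem MState.after_deal_le (hα : 2 ≤ α) (hw : ∀ v, 0 < w v) (i : ℕ) {e : Finset V}
    (he : e ∈ H.edges) : (MState.after H w β α (1 / 2) i).deal e
      ≤ α ^ i * (MState.init H w).deal e := by
  induction i with
  | zero => simp [MState.after]
  | succ i ih =>
    rw [MState.after_succ]
    set S := MState.after H w β α (1 / 2) i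
    have hS : S.Inv H w := MState.Inv.after hα hw i
    have hdeal := hS.deal_pos e he
    have h1 : S.scaledDeal H w β e ≤ S.deal e :=
      mul_le_of_le_one_right hdeal.le (pow_le_one₀ (by norm_num) (by norm_num))
    have h2 : (S.next H w β α).deal e ≤ α * S.deal e := by
      by_cases hu : e ∈ H.uncovered (S.newCover H w β)
      · by_cases hr : ∀ v ∈ e, S.Raises H w β α v
        · rw [MState.next_deal_of_raise hu hr]
          exact mul_le_mul_of_nonneg_left h1 (by linarith)
        · rw [MState.next_deal_of_stuck hu hr]
          nlinarith
      · rw [MState.next_deal_of_covered hu]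
        nlinarith
    rw [pow_succ']
    nlinarith

/-- The deal of iteration `i + 1` is at most `α ^ (i + 1)` times the initial one, and `(1 + α) ^ i +
α ^ (i + 1) ≤ (1 + α) ^ (i + 1)`. -/
theorem MState.after_dual_le (hα : 2 ≤ α) (hw : ∀ v, 0 < w v) (i : ℕ) {e : Finset V}
    (he : e ∈ H.edges) : (MState.after H w β α (1 / 2) i).dual e
      ≤ (1 + α) ^ i * (MState.init H w).deal e := by
  induction i with
  | zero => simp [MState.after, MState.init_dual]
  | succ i ih =>
    have hd := MState.after_deal_le (H := H) (β := β) hα hw (i + 1) he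
    have hpos := MState.init_deal_pos hw he
    have h1 : (MState.after H w β α (1 / 2) (i + 1)).dual e
        ≤ (MState.after H w β α (1 / 2) i).dual e
          + (MState.after H w β α (1 / 2) (i + 1)).deal e := by
      have h2 := (MState.Inv.after (H := H) (β := β) hα hw (i + 1)).deal_pos e he
      rw [MState.after_succ] at h2 ⊢
      by_cases hu : e ∈ H.uncovered ((MState.after H w β α (1 / 2) i).newCover H w β)
      · rw [MState.next_dual hu]
        linarith
      · rw [MState.next_dual_of_covered hu]
        linarith
    have h3 : α ^ (i + 1) ≤ α * (1 + α) ^ i := by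
      rw [pow_succ']
      exact mul_le_mul_of_nonneg_left (pow_le_pow_left₀ (by linarith) (by linarith) i) (by linarith)
    have h4 := mul_le_mul_of_nonneg_right h3 hpos.le
    rw [pow_succ']
    nlinarith

/-- A vertex does not join the cover as long as its load cannot have reached its weight. -/
theorem MState.notMem_cover_of_small (hα : 2 ≤ α) (hw : ∀ v, 0 < w v) {v : V} {i : ℕ}
    (h : (1 + α) ^ i * ∑ e ∈ H.incident v, (MState.init H w).deal e < (1 - β) * w v) :
    v ∉ (MState.after H w β α (1 / 2) (i + 1)).cover := by
  intro hv
  have key : ∀ k ≤ i, v ∈ (MState.after H w β α (1 / 2) (k + 1)).cover →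
      v ∈ (MState.after H w β α (1 / 2) k).cover := by
    intro k hk hv
    rw [MState.after_succ, MState.next_cover, MState.mem_newCover] at hv
    refine hv.resolve_right fun hload => ?_
    have h1 : (MState.after H w β α (1 / 2) k).load H v
        ≤ (1 + α) ^ k * ∑ e ∈ H.incident v, (MState.init H w).deal e := by
      rw [Finset.mul_sum]
      exact Finset.sum_le_sum fun e he =>
        MState.after_dual_le hα hw k (Hypergraph.mem_incident.1 he).1
    have h2 : (1 + α) ^ k ≤ (1 + α) ^ i := pow_le_pow_right₀ (by linarith) hk
    have h3 : 0 ≤ ∑ e ∈ H.incident v, (MState.init H w).deal e :=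
      Finset.sum_nonneg fun e he => (MState.init_deal_pos hw (Hypergraph.mem_incident.1 he).1).le
    have := hload.2.trans (h1.trans (mul_le_mul_of_nonneg_right h2 h3))
    linarith
  have : ∀ k ≤ i + 1, v ∉ (MState.after H w β α (1 / 2) k).cover := by
    intro k hk
    induction k with
    | zero => simp [MState.after, MState.init]
    | succ k ih => exact fun h => ih (by omega) (key k (by omega) h)
  exact this _ le_rfl hv

/-- The star with center `0` and `D` leaves. -/
def starHypergraph (D : ℕ) : Hypergraph (Fin (D + 1)) where
  edges := Finset.univ.image fun j : Fin D => {0, j.succ}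
  nonempty_of_mem e he := by
    obtain ⟨j, _, rfl⟩ := Finset.mem_image.1 he
    exact ⟨0, by simp⟩

/-- All leaves but the first one are very light. -/
noncomputable def starWeight (D : ℕ) (v : Fin (D + 1)) : ℝ :=
  if (v : ℕ) ≤ 1 then 1 else 1 / (D : ℝ) ^ 2

theorem mem_starHypergraph {D : ℕ} {e : Finset (Fin (D + 1))} :
    e ∈ (starHypergraph D).edges ↔ ∃ j : Fin D, {0, j.succ} = e := by
  simp [starHypergraph]

theorem starHypergraph_incident_zero (D : ℕ) :
    (starHypergraph D).incident 0 = (starHypergraph D).edges := by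
  refine Finset.filter_true_of_mem fun e he => ?_
  obtain ⟨j, rfl⟩ := mem_starHypergraph.1 he
  simp

theorem starHypergraph_incident_succ {D : ℕ} (j : Fin D) :
    (starHypergraph D).incident j.succ = {{0, j.succ}} := by
  ext e
  rw [Hypergraph.mem_incident, mem_starHypergraph, Finset.mem_singleton]
  constructor
  · rintro ⟨⟨k, rfl⟩, h⟩
    simp only [Finset.mem_insert, Finset.mem_singleton, Fin.succ_inj, Fin.succ_ne_zero, false_or]
      at h
    rw [h]
  · rintro rfl
    exact ⟨⟨j, rfl⟩, by simp⟩

theorem pair_zero_succ_injective (D : ℕ) :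
    Function.Injective fun j : Fin D => ({0, j.succ} : Finset (Fin (D + 1))) := by
  intro j k h
  have h1 : j.succ ∈ ({0, k.succ} : Finset (Fin (D + 1))) := by
    rw [← show ({0, j.succ} : Finset (Fin (D + 1))) = {0, k.succ} from h]
    simp
  simpa [Fin.succ_ne_zero] using h1

theorem card_starHypergraph_edges (D : ℕ) : (starHypergraph D).edges.card = D := by
  rw [starHypergraph, Finset.card_image_of_injective _ (pair_zero_succ_injective D)]
  simp

theorem starHypergraph_deal_le {D : ℕ} (hD : 0 < D) (j : Fin D) :
    (MState.init (starHypergraph D) (starWeight D)).deal {0, j.succ}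
      ≤ if (j : ℕ) = 0 then 1 / (2 * (D : ℝ)) else 1 / (2 * (D : ℝ) ^ 2) := by
  have hD' : (0 : ℝ) < D := by exact_mod_cast hD
  split_ifs with hj
  · refine (MState.init_deal_le (v := 0) (by simp)).trans_eq ?_
    rw [starHypergraph_incident_zero, card_starHypergraph_edges]
    simp [starWeight]
    ring
  · refine (MState.init_deal_le (v := j.succ) (by simp)).trans_eq ?_
    rw [starHypergraph_incident_succ]
    have : ¬ ((j : ℕ) = 0) := hj
    simp [starWeight, this]
    ring

theorem starWeight_pos {D : ℕ} (hD : 0 < D) (v : Fin (D + 1)) : 0 < starWeight D v := by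
  have hD' : (0 : ℝ) < D := by exact_mod_cast hD
  unfold starWeight
  split_ifs <;> positivity

/-- The first edge contributes at most `1 / (2 D)`, and so do all others together because their
leaves are light. With equal weights the center would start with load `1 / 2`, which gives no lower
bound. -/
theorem starHypergraph_sum_deal_le {D : ℕ} (hD : 0 < D) :
    ∑ e ∈ (starHypergraph D).edges, (MState.init (starHypergraph D) (starWeight D)).deal e
      ≤ 1 / D := by
  have hD' : (0 : ℝ) < D := by exact_mod_cast hD
  have h0 : (starHypergraph D).edges = Finset.univ.image fun j : Fin D => {0, j.succ} := rfl
  rw [h0, Finset.sum_image fun j _ k _ h => pair_zero_succ_injective D h]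
  refine (Finset.sum_le_sum fun j _ => starHypergraph_deal_le hD j).trans ?_
  have h1 : ∀ j : Fin D, (if (j : ℕ) = 0 then 1 / (2 * (D : ℝ)) else 1 / (2 * (D : ℝ) ^ 2))
      ≤ (if j = ⟨0, hD⟩ then 1 / (2 * (D : ℝ)) else 0) + 1 / (2 * (D : ℝ) ^ 2) := by
    intro j
    have hp : 0 ≤ 1 / (2 * (D : ℝ) ^ 2) := by positivity
    by_cases hj : (j : ℕ) = 0
    · rw [if_pos hj, if_pos (Fin.ext hj)]
      linarith
    · rw [if_neg hj, if_neg fun h => hj (by rw [h])]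
      linarith
  refine (Finset.sum_le_sum fun j _ => h1 j).trans_eq ?_
  rw [Finset.sum_add_distrib, Finset.sum_ite_eq' Finset.univ, if_pos (Finset.mem_univ _),
    Finset.sum_const, Finset.card_univ, Fintype.card_fin, nsmul_eq_mul]
  field_simp
  norm_num

/-- In the star, the center and the first leaf have weight `1` and initial loads of at most `1 / D`.
Both stay outside the cover through iteration `i + 1`, so the edge joining them is still uncovered.
-/
theorem le_mwhvcRounds {γ ε : ℝ} {f D i : ℕ} (hf : 2 ≤ f) (hD : 0 < D) (hε : 0 < ε) (hε1 : ε ≤ 1)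
    (hi : (1 + multiplier γ f D ε) ^ i < (D : ℝ) / 2) :
    ((2 + 4 * (i + 2) : ℕ) : ℕ∞) ≤ mwhvcRounds γ f D ε := by
  have hD' : (0 : ℝ) < D := by exact_mod_cast hD
  have hf' : (2 : ℝ) ≤ f := by exact_mod_cast hf
  set H := starHypergraph D with hH
  have hw := starWeight_pos hD
  have hα := two_le_multiplier γ f D ε
  set α := multiplier γ f D ε with hαdef
  have hrank : H.RankLE f := by
    intro e he
    obtain ⟨j, rfl⟩ := mem_starHypergraph.1 he
    exact Finset.card_le_two.trans hf
  have hdeg : H.DegreeLE D := by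
    intro v
    exact (Finset.card_le_card (Finset.filter_subset _ _)).trans_eq (card_starHypergraph_edges D)
  refine le_trans ?_ (le_iSup_of_le (D + 1) (le_iSup_of_le H (le_iSup_of_le (starWeight D)
    (le_iSup_of_le ⟨hrank, hdeg, hw⟩ le_rfl))))
  refine le_iInf fun k => le_iInf fun hk => ?_
  rw [Nat.cast_le]
  by_contra hlt
  have hki : k ≤ i + 1 := by omega
  -- Here `f ≥ 2` and `ε ≤ 1` are needed: a load below `1 / 2` is then never tight.
  have hβ : 1 / 2 < 1 - ε / (f + ε) := by
    have : ε / (f + ε) < 1 / 2 := by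
      rw [div_lt_div_iff₀ (by linarith) (by norm_num)]
      linarith
    linarith
  have hsum := starHypergraph_sum_deal_le hD
  have hαi : (0 : ℝ) < (1 + α) ^ i := by positivity
  have hsmall : (1 + α) ^ i * (1 / D) < 1 / 2 := by
    rw [mul_one_div, div_lt_iff₀ hD']
    linarith
  have hinit : ∀ e ∈ H.edges, 0 ≤ (MState.init H (starWeight D)).deal e := fun e he =>
    (MState.init_deal_pos hw he).le
  have hsmall' : ∀ v, starWeight D v = 1 →
      v ∉ (MState.after H (starWeight D) (ε / (f + ε)) α (1 / 2) (i + 1)).cover := by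
    intro v hv
    refine MState.notMem_cover_of_small hα hw ?_
    rw [hv, mul_one]
    refine lt_of_le_of_lt (mul_le_mul_of_nonneg_left ?_ hαi.le) (hsmall.trans hβ)
    exact (Finset.sum_le_sum_of_subset_of_nonneg (Finset.filter_subset _ _)
      fun e he _ => hinit e he).trans hsum
  have he : ({0, (⟨0, hD⟩ : Fin D).succ} : Finset (Fin (D + 1))) ∈
      H.uncovered (MState.after H (starWeight D) (ε / (f + ε)) α (1 / 2) k).cover := by
    refine Hypergraph.uncovered_anti (MState.after_cover_mono hki) (Hypergraph.mem_uncovered.2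
      ⟨mem_starHypergraph.2 ⟨_, rfl⟩, ?_⟩)
    rw [Finset.disjoint_left]
    intro v hv
    refine hsmall' v ?_
    rw [Finset.mem_insert, Finset.mem_singleton] at hv
    rcases hv with rfl | rfl <;> simp [starWeight]
  rw [hk] at he
  exact absurd he (Finset.notMem_empty _)

/-- The empty hypergraph already pays for iteration `0`. -/
theorem two_le_mwhvcRounds (γ : ℝ) (f D : ℕ) (ε : ℝ) : 2 ≤ mwhvcRounds γ f D ε := by
  have h : ∀ (H : Hypergraph (Fin 0)) (w : Fin 0 → ℝ),
      2 ≤ mwhvcRoundsOn H w (ε / (f + ε)) (multiplier γ f D ε) (1 / 2) := fun H w =>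
    le_iInf fun k => le_iInf fun _ => by
      rw [show (2 : ℕ∞) = ((2 : ℕ) : ℕ∞) from rfl, Nat.cast_le]
      omega
  refine (h ⟨∅, by simp⟩ fun _ => 1).trans (le_iSup_of_le 0 (le_iSup_of_le _ (le_iSup_of_le _
    (le_iSup_of_le ⟨?_, ?_, ?_⟩ le_rfl))))
  · intro e he
    simp at he
  · intro v
    exact v.elim0
  · intro v
    exact v.elim0

/-- The rank is at most proportional to the number of rounds of Algorithm MWHVC. -/
theorem rank_le_mwhvcRounds {γ ε : ℝ} {f D T : ℕ} (hf : 2 ≤ f) (hD4 : 4 ≤ D) (hD : 2 ^ f ≤ D)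
    (hε : 0 < ε) (hε1 : ε ≤ 1) (hT : mwhvcRounds γ f D ε = T) : f ≤ 4 * T := by
  have hX := one_lt_log_of_four_le hD4
  have hlX := log_log_gt_of_four_le hD4
  have hlog2 := Real.log_two_gt_d9
  have hα2 := two_le_multiplier γ f D ε
  have hfX : f * Real.log 2 ≤ Real.log D := by
    rw [← Real.log_pow]
    exact Real.log_le_log (by positivity) (by exact_mod_cast hD)
  -- For `α = 2` this is `2 ^ f ≤ D`. For `α = q` use `log (1 + q) ≤ q` and `f q log (f / ε) log log
  -- D = log D`, where the product of the last two factors on the left is at least `1 / 6`.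
  have hfα : f * Real.log (1 + multiplier γ f D ε) ≤ 6 * Real.log D := by
    have htwo : f * Real.log (1 + 2) ≤ 6 * Real.log D := by
      have h1 : Real.log (1 + 2) ≤ 2 * Real.log 2 := by
        rw [show (2 : ℝ) * Real.log 2 = Real.log (2 ^ 2) by rw [Real.log_pow]; norm_num]
        exact Real.log_le_log (by norm_num) (by norm_num)
      nlinarith [Nat.cast_nonneg (α := ℝ) f]
    have hα : multiplier γ f D ε = 2 ∨ multiplier γ f D ε
        = Real.log D / (f * Real.log (f / ε) * Real.log (Real.log D)) := by
      unfold multiplier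
      simp only
      split_ifs
      · exact max_choice _ _
      · exact Or.inl rfl
    rcases hα with hα | hα
    · rwa [hα]
    · have hL := log_two_le_log_div hf hε hε1
      set q := multiplier γ f D ε with hq
      have hf' : (2 : ℝ) ≤ f := by exact_mod_cast hf
      have hqX : q * (f * Real.log (f / ε) * Real.log (Real.log D)) = Real.log D := by
        rw [hα, div_mul_cancel₀]
        have : 0 < Real.log (f / ε) := by linarith
        positivity
      have h1 : Real.log (1 + q) ≤ q := by
        linarith [Real.log_le_sub_one_of_pos (show 0 < 1 + q by linarith)]
      have h2 : f * Real.log (1 + q) ≤ f * q := mul_le_mul_of_nonneg_left h1 (by linarith)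
      have h3 : (1 : ℝ) / 6 ≤ Real.log (f / ε) * Real.log (Real.log D) := by nlinarith
      have h4 := mul_le_mul_of_nonneg_left h3 (show 0 ≤ f * q by nlinarith)
      nlinarith
  have hlα : 0 < Real.log (1 + multiplier γ f D ε) := Real.log_pos (by linarith)
  have hex : ∃ i : ℕ, (D : ℝ) / 2 ≤ (1 + multiplier γ f D ε) ^ i := by
    obtain ⟨i, hi⟩ := pow_unbounded_of_one_lt ((D : ℝ) / 2)
      (show 1 < 1 + multiplier γ f D ε by linarith)
    exact ⟨i, hi.le⟩
  classical
  have hfind := Nat.find_spec hex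
  obtain ⟨k, hk⟩ : ∃ k, Nat.find hex = k + 1 := by
    refine Nat.exists_eq_succ_of_ne_zero fun h0 => ?_
    rw [h0, pow_zero] at hfind
    have : (4 : ℝ) ≤ D := by exact_mod_cast hD4
    linarith
  -- By minimality of `k + 1`, the exponent `k` satisfies the hypothesis of the lower bound, while
  -- `k + 1` gives `log (D / 2) ≤ (k + 1) log (1 + α)`.
  have hlt := le_mwhvcRounds (γ := γ) hf (by omega : 0 < D) hε hε1
    (not_le.1 (Nat.find_min hex (m := k) (by omega)))
  rw [hT, Nat.cast_le] at hlt
  rw [hk] at hfind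
  have h1 : Real.log D - Real.log 2 ≤ (k + 1) * Real.log (1 + multiplier γ f D ε) := by
    rw [← Real.log_div (by positivity) (by norm_num)]
    refine (Real.log_le_log (by positivity) hfind).trans_eq ?_
    rw [Real.log_pow]
    push_cast
    ring
  have hlog2' := Real.log_two_lt_d9
  have h2 : f * Real.log (1 + multiplier γ f D ε)
      ≤ (16 * (k + 1)) * Real.log (1 + multiplier γ f D ε) := by nlinarith
  have h3 : (f : ℝ) ≤ 16 * (k + 1) := le_of_mul_le_mul_right h2 hlα
  have h4 : f ≤ 16 * (k + 1) := by exact_mod_cast h3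
  omega

end LowerBound

/-! ## Locality of Algorithm MWHVC -/

section Locality

variable {V : Type} [Fintype V] [DecidableEq V] {H H' : Hypergraph V} {w w' : V → ℝ} {β α : ℝ}
  {S S' : MState V} {v : V} {U : Set V} {E : Finset (Finset V)}

/-- Two states agree on the vertices in `U` and the hyperedges in `E`. -/
structure MState.Agree (U : Set V) (E : Finset (Finset V)) (S S' : MState V) : Prop where
  cover : ∀ u ∈ U, u ∈ S.cover ↔ u ∈ S'.cover
  level : ∀ u ∈ U, S.level u = S'.level u
  deal : ∀ e ∈ E, S.deal e = S'.deal e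
  dual : ∀ e ∈ E, S.dual e = S'.dual e

/-- The numbers that vertices broadcast: first the degree, then in each iteration whether the vertex
is in the cover, by how much its level has increased, and whether it raises. -/
noncomputable def statusNumber (H : Hypergraph V) (w : V → ℝ) (β α : ℝ) (p : ℕ) (v : V) : ℕ :=
  open Classical in
  let S := MState.after H w β α (1 / 2) ((p - 1) / 3)
  if p = 0 then (H.incident v).card
  else if (p - 1) % 3 = 0 then if v ∈ S.newCover H w β then 1 else 0
  else if (p - 1) % 3 = 1 then S.newLevel H w (S.newCover H w β) v - S.level v
  else if S.Raises H w β α v then 1 else 0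

theorem statusNumber_zero : statusNumber H w β α 0 v = (H.incident v).card := by
  simp [statusNumber]

open Classical in
theorem statusNumber_cover (k : ℕ) : statusNumber H w β α (3 * k + 1) v
    = if v ∈ (MState.after H w β α (1 / 2) k).newCover H w β then 1 else 0 := by
  have h1 : (3 * k + 1 - 1) / 3 = k := by omega
  have h2 : (3 * k + 1 - 1) % 3 = 0 := by omega
  simp only [statusNumber, h1, h2]
  simp

theorem statusNumber_level (k : ℕ) : statusNumber H w β α (3 * k + 2) v
    = (MState.after H w β α (1 / 2) k).newLevel H w
        ((MState.after H w β α (1 / 2) k).newCover H w β) v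
      - (MState.after H w β α (1 / 2) k).level v := by
  have h1 : (3 * k + 2 - 1) / 3 = k := by omega
  have h2 : (3 * k + 2 - 1) % 3 = 1 := by omega
  simp only [statusNumber, h1, h2]
  simp

open Classical in
theorem statusNumber_raise (k : ℕ) : statusNumber H w β α (3 * k + 3) v
    = if (MState.after H w β α (1 / 2) k).Raises H w β α v then 1 else 0 := by
  have h1 : (3 * k + 3 - 1) / 3 = k := by omega
  have h2 : (3 * k + 3 - 1) % 3 = 2 := by omega
  simp only [statusNumber, h1, h2]
  simp

theorem exists_phase (p : ℕ) (hp : p ≠ 0) :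
    ∃ k, p = 3 * k + 1 ∨ p = 3 * k + 2 ∨ p = 3 * k + 3 :=
  ⟨(p - 1) / 3, by omega⟩

theorem statusNumber_lt_two (hα : 2 ≤ α) (hw : ∀ v, 0 < w v) {p : ℕ} (hp : p ≠ 0) :
    statusNumber H w β α p v < 2 := by
  obtain ⟨k, rfl | rfl | rfl⟩ := exists_phase p hp
  · rw [statusNumber_cover]
    split_ifs <;> norm_num
  · rw [statusNumber_level]
    have := MState.newLevel_le (MState.Inv.after (H := H) (β := β) hα hw k)
      ((MState.after H w β α (1 / 2) k).newCover H w β) v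
    omega
  · rw [statusNumber_raise]
    split_ifs <;> norm_num

theorem Hypergraph.mem_uncovered_congr {C C' e : Finset V} (he : e ∈ H.edges) (he' : e ∈ H'.edges)
    (hC : ∀ u ∈ e, u ∈ C ↔ u ∈ C') : e ∈ H.uncovered C ↔ e ∈ H'.uncovered C' := by
  simp only [Hypergraph.mem_uncovered, he, he', true_and, Finset.disjoint_left]
  exact forall₂_congr fun u hu => not_congr (hC u hu)

theorem Hypergraph.uncoveredAt_congr {C C' : Finset V} (hE : H.incident v = H'.incident v)
    (hC : ∀ e ∈ H.incident v, ∀ u ∈ e, u ∈ C ↔ u ∈ C') :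
    H.uncoveredAt C v = H'.uncoveredAt C' v := by
  have key : ∀ (H : Hypergraph V) (C : Finset V),
      H.uncoveredAt C v = (H.incident v).filter fun e => Disjoint e C := by
    intro H C
    ext e
    simp only [Hypergraph.mem_uncoveredAt, Hypergraph.mem_uncovered, Finset.mem_filter,
      Hypergraph.mem_incident]
    tauto
  rw [key, key, ← hE]
  refine Finset.filter_congr fun e he => ?_
  simp only [Finset.disjoint_left]
  exact forall₂_congr fun u hu => not_congr (hC e he u hu)

theorem MState.Agree.init (hE : ∀ e ∈ E, ∀ u ∈ e, u ∈ U) (hw : ∀ u ∈ U, w u = w' u)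
    (hdeg : ∀ u ∈ U, (H.incident u).card = (H'.incident u).card) :
    (MState.init H w).Agree U E (MState.init H' w') := by
  have hd : ∀ e ∈ E, (MState.init H w).deal e = (MState.init H' w').deal e := by
    intro e he
    by_cases h : e.Nonempty
    · rw [MState.init_deal h, MState.init_deal h]
      congr 1
      refine Finset.inf'_congr h rfl fun u hu => ?_
      rw [hw u (hE e he u hu), hdeg u (hE e he u hu)]
    · simp [MState.init, h]
  refine { cover := fun u _ => ?_, level := fun u _ => ?_, deal := hd, dual := fun e he => ?_ }
  · simp only [MState.init]
  · simp only [MState.init]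
  · have h := hd e he
    rwa [← MState.init_dual, ← MState.init_dual] at h

theorem MState.Agree.scaledDeal (h : S.Agree U E S')
    (hE : ∀ e ∈ E, ∀ u ∈ e, u ∈ U)
    (hlev : ∀ u ∈ U, S.newLevel H w (S.newCover H w β) u = S'.newLevel H' w' (S'.newCover H' w' β) u)
    {e : Finset V} (he : e ∈ E) : S.scaledDeal H w β e = S'.scaledDeal H' w' β e := by
  rw [MState.scaledDeal, MState.scaledDeal, h.deal e he, Finset.sum_congr rfl fun u hu => by
    rw [hlev u (hE e he u hu), h.level u (hE e he u hu)]]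

/-- Decisions of vertices in `U` may depend on hyperedges outside `E`; taking their agreement as
hypotheses closes the induction on `U` and `E` alone. -/
theorem MState.Agree.next (h : S.Agree U E S') (hE : ∀ e ∈ E, ∀ u ∈ e, u ∈ U)
    (hH : ∀ e ∈ E, e ∈ H.edges) (hH' : ∀ e ∈ E, e ∈ H'.edges)
    (hcov : ∀ u ∈ U, u ∈ S.newCover H w β ↔ u ∈ S'.newCover H' w' β)
    (hlev : ∀ u ∈ U, S.newLevel H w (S.newCover H w β) u = S'.newLevel H' w' (S'.newCover H' w' β) u)
    (hraise : ∀ u ∈ U, S.Raises H w β α u ↔ S'.Raises H' w' β α u) :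
    (S.next H w β α).Agree U E (S'.next H' w' β α) := by
  have hu : ∀ e ∈ E, e ∈ H.uncovered (S.newCover H w β) ↔ e ∈ H'.uncovered (S'.newCover H' w' β) :=
    fun e he => Hypergraph.mem_uncovered_congr (hH e he) (hH' e he) fun u hu => hcov u (hE e he u hu)
  have hr : ∀ e ∈ E, (∀ v ∈ e, S.Raises H w β α v) ↔ ∀ v ∈ e, S'.Raises H' w' β α v :=
    fun e he => forall₂_congr fun u hu => hraise u (hE e he u hu)
  have hdeal : ∀ e ∈ E, (S.next H w β α).deal e = (S'.next H' w' β α).deal e := by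
    intro e he
    by_cases h1 : e ∈ H.uncovered (S.newCover H w β)
    · have h1' := (hu e he).1 h1
      by_cases h2 : ∀ v ∈ e, S.Raises H w β α v
      · rw [MState.next_deal_of_raise h1 h2, MState.next_deal_of_raise h1' ((hr e he).1 h2),
          h.scaledDeal hE hlev he]
      · rw [MState.next_deal_of_stuck h1 h2,
          MState.next_deal_of_stuck h1' fun h3 => h2 ((hr e he).2 h3), h.scaledDeal hE hlev he]
    · have h1' := fun h3 => h1 ((hu e he).2 h3)
      rw [MState.next_deal_of_covered h1, MState.next_deal_of_covered h1', h.deal e he]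
  refine ⟨hcov, hlev, hdeal, fun e he => ?_⟩
  by_cases h1 : e ∈ H.uncovered (S.newCover H w β)
  · rw [MState.next_dual h1, MState.next_dual ((hu e he).1 h1), hdeal e he, h.dual e he]
  · have h1' := fun h3 => h1 ((hu e he).2 h3)
    rw [MState.next_dual_of_covered h1, MState.next_dual_of_covered h1', h.dual e he]

theorem mem_newCover_of_statusNumber_eq {k : ℕ}
    (h : statusNumber H w β α (3 * k + 1) v = statusNumber H' w' β α (3 * k + 1) v) :
    v ∈ (MState.after H w β α (1 / 2) k).newCover H w β
      ↔ v ∈ (MState.after H' w' β α (1 / 2) k).newCover H' w' β := by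
  rw [statusNumber_cover, statusNumber_cover] at h
  split_ifs at h <;> simp_all

theorem raises_of_statusNumber_eq {k : ℕ}
    (h : statusNumber H w β α (3 * k + 3) v = statusNumber H' w' β α (3 * k + 3) v) :
    (MState.after H w β α (1 / 2) k).Raises H w β α v
      ↔ (MState.after H' w' β α (1 / 2) k).Raises H' w' β α v := by
  rw [statusNumber_raise, statusNumber_raise] at h
  split_ifs at h <;> simp_all

/-- Only the increment is broadcast; it is added to the known old level. Monotonicity of levels
makes the truncated subtraction harmless. -/
theorem newLevel_eq_of_statusNumber_eq (hα : 2 ≤ α) (hw : ∀ v, 0 < w v) (hw' : ∀ v, 0 < w' v) {k : ℕ}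
    (h : statusNumber H w β α (3 * k + 2) v = statusNumber H' w' β α (3 * k + 2) v)
    (hl : (MState.after H w β α (1 / 2) k).level v = (MState.after H' w' β α (1 / 2) k).level v) :
    (MState.after H w β α (1 / 2) k).newLevel H w
        ((MState.after H w β α (1 / 2) k).newCover H w β) v
      = (MState.after H' w' β α (1 / 2) k).newLevel H' w'
        ((MState.after H' w' β α (1 / 2) k).newCover H' w' β) v := by
  rw [statusNumber_level, statusNumber_level] at h
  have h1 := MState.le_newLevel (MState.Inv.after (H := H) (β := β) hα hw k)
    ((MState.after H w β α (1 / 2) k).newCover H w β) v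
  have h2 := MState.le_newLevel (MState.Inv.after (H := H') (β := β) hα hw' k)
    ((MState.after H' w' β α (1 / 2) k).newCover H' w' β) v
  omega

theorem MState.Agree.after (hα : 2 ≤ α) (hw : ∀ v, 0 < w v) (hw' : ∀ v, 0 < w' v)
    (hE : ∀ e ∈ E, ∀ u ∈ e, u ∈ U) (hH : ∀ e ∈ E, e ∈ H.edges) (hH' : ∀ e ∈ E, e ∈ H'.edges)
    (hww' : ∀ u ∈ U, w u = w' u) {k : ℕ}
    (hs : ∀ q < 3 * k + 1, ∀ u ∈ U, statusNumber H w β α q u = statusNumber H' w' β α q u) :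
    (MState.after H w β α (1 / 2) k).Agree U E (MState.after H' w' β α (1 / 2) k) := by
  induction k with
  | zero =>
    refine MState.Agree.init hE hww' fun u hu => ?_
    simpa only [statusNumber_zero] using hs 0 (by omega) u hu
  | succ k ih =>
    have h := ih fun q hq => hs q (by omega)
    rw [MState.after_succ, MState.after_succ]
    exact h.next hE hH hH'
      (fun u hu => mem_newCover_of_statusNumber_eq (hs (3 * k + 1) (by omega) u hu))
      (fun u hu => newLevel_eq_of_statusNumber_eq hα hw hw' (hs (3 * k + 2) (by omega) u hu)
        (h.level u hu))
      fun u hu => raises_of_statusNumber_eq (hs (3 * k + 3) (by omega) u hu)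

/-- The earlier numbers of the vertices in `U` determine the state on the hyperedges at `v`, and the
decision of `v` reads nothing else. Within an iteration, the level uses the new cover, and the raise
test uses the new cover and levels. -/
theorem statusNumber_eq_of_closed (hα : 2 ≤ α) (hw : ∀ v, 0 < w v) (hw' : ∀ v, 0 < w' v)
    (hinc : H.incident v = H'.incident v) (hv : v ∈ U) (hE : ∀ e ∈ H.incident v, ∀ u ∈ e, u ∈ U)
    (hww' : ∀ u ∈ U, w u = w' u) {p : ℕ}
    (hs : ∀ q < p, ∀ u ∈ U, statusNumber H w β α q u = statusNumber H' w' β α q u) :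
    statusNumber H w β α p v = statusNumber H' w' β α p v := by
  by_cases hp : p = 0
  · rw [hp, statusNumber_zero, statusNumber_zero, hinc]
  obtain ⟨k, hk⟩ := exists_phase p hp
  have hH : ∀ e ∈ H.incident v, e ∈ H.edges := fun e he => (Hypergraph.mem_incident.1 he).1
  have hH' : ∀ e ∈ H.incident v, e ∈ H'.edges := fun e he =>
    (Hypergraph.mem_incident.1 (hinc ▸ he)).1
  have hag := MState.Agree.after (k := k) hα hw hw' hE hH hH' hww' fun q hq => hs q (by omega)
  have hload : (MState.after H w β α (1 / 2) k).load H v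
      = (MState.after H' w' β α (1 / 2) k).load H' v := by
    rw [MState.load, MState.load, ← hinc]
    exact Finset.sum_congr rfl hag.dual
  have hcov : v ∈ (MState.after H w β α (1 / 2) k).newCover H w β
      ↔ v ∈ (MState.after H' w' β α (1 / 2) k).newCover H' w' β := by
    rw [MState.mem_newCover, MState.mem_newCover, hload, hag.cover v hv, hww' v hv,
      Hypergraph.uncoveredAt_congr hinc fun e he u hu => hag.cover u (hE e he u hu)]
  rcases hk with rfl | rfl | rfl
  · rw [statusNumber_cover, statusNumber_cover]
    exact if_congr hcov rfl rfl
  all_goals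
    have hunc : H.uncoveredAt ((MState.after H w β α (1 / 2) k).newCover H w β) v
        = H'.uncoveredAt ((MState.after H' w' β α (1 / 2) k).newCover H' w' β) v :=
      Hypergraph.uncoveredAt_congr hinc fun e he u hu =>
        mem_newCover_of_statusNumber_eq (hs (3 * k + 1) (by omega) u (hE e he u hu))
  · rw [statusNumber_level, statusNumber_level]
    simp only [MState.newLevel]
    rw [hunc, hload, hag.level v hv, hww' v hv]
  · have hlev := fun u hu => newLevel_eq_of_statusNumber_eq hα hw hw'
      (hs (3 * k + 2) (by omega) u hu) (hag.level u hu)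
    rw [statusNumber_raise, statusNumber_raise]
    classical
    refine if_congr ?_ rfl rfl
    rw [MState.Raises, MState.Raises, hlev v hv, ← hunc, hww' v hv]
    rw [Finset.sum_congr rfl fun e he => hag.scaledDeal hE hlev
      (Hypergraph.uncoveredAt_subset_incident _ _ he)]

/-- A vertex can compute its status numbers from the previous ones of the vertices that share a
hyperedge with it. -/
theorem statusNumber_eq (hα : 2 ≤ α) (hw : ∀ v, 0 < w v) (hw' : ∀ v, 0 < w' v)
    (hinc : H.incident v = H'.incident v) (hwv : w v = w' v)
    (hww' : ∀ e ∈ H.incident v, ∀ u ∈ e, w u = w' u) {p : ℕ}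
    (hs : ∀ q < p, ∀ e ∈ H.incident v, ∀ u ∈ e,
      statusNumber H w β α q u = statusNumber H' w' β α q u) :
    statusNumber H w β α p v = statusNumber H' w' β α p v := by
  induction p using Nat.strong_induction_on with
  | _ p ih =>
    -- The vertex itself is put into `U` because it may lie in no hyperedge; its own earlier numbers
    -- come from the induction.
    refine statusNumber_eq_of_closed (U := {u | u = v ∨ ∃ e ∈ H.incident v, u ∈ e}) hα hw hw' hinc
      (Or.inl rfl) (fun e he u hu => Or.inr ⟨e, he, hu⟩) ?_ ?_
    · rintro u (rfl | ⟨e, he, hu⟩)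
      · exact hwv
      · exact hww' e he u hu
    · rintro q hq u (rfl | ⟨e, he, hu⟩)
      · exact ih q hq fun q' hq' => hs q' (by omega)
      · exact hs q hq e he u hu

end Locality

/-! ## The hypergraph of a covering program -/

section Reduction

variable {m n : ℕ} {A A' : Matrix (Fin m) (Fin n) ℝ} {b b' : Fin m → ℝ} {w w' : Fin n → ℝ}

/-- The hyperedges are the sets of variables of positive weight of a constraint that must not all be
zero. -/
noncomputable def coverHypergraph (A : Matrix (Fin m) (Fin n) ℝ) (b : Fin m → ℝ) (w : Fin n → ℝ) :
    Hypergraph (Fin n) where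
  edges := open Classical in Finset.univ.filter fun e => e.Nonempty ∧ ∃ i, e ⊆ rowVars A i ∧
    (∀ j ∈ e, w j ≠ 0) ∧ ∑ j ∈ rowVars A i \ e, A i j < b i
  nonempty_of_mem _ he := (Finset.mem_filter.1 he).2.1

theorem mem_coverHypergraph {e : Finset (Fin n)} : e ∈ (coverHypergraph A b w).edges ↔
    e.Nonempty ∧ ∃ i, e ⊆ rowVars A i ∧ (∀ j ∈ e, w j ≠ 0) ∧ ∑ j ∈ rowVars A i \ e, A i j < b i := by
  simp [coverHypergraph]

theorem coverHypergraph_rankLE : (coverHypergraph A b w).RankLE (rowSupport A) := by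
  intro e he
  obtain ⟨_, i, hi, _⟩ := mem_coverHypergraph.1 he
  exact (Finset.card_le_card hi).trans (card_rowVars_le A i)

theorem coverHypergraph_degreeLE :
    (coverHypergraph A b w).DegreeLE (2 ^ rowSupport A * colSupport A) := by
  intro j
  have hsub : (coverHypergraph A b w).incident j
      ⊆ (Finset.univ.filter fun i => A i j ≠ 0).biUnion fun i => (rowVars A i).powerset := by
    intro e he
    obtain ⟨he, hj⟩ := Hypergraph.mem_incident.1 he
    obtain ⟨_, i, hi, _⟩ := mem_coverHypergraph.1 he
    refine Finset.mem_biUnion.2 ⟨i, ?_, Finset.mem_powerset.2 hi⟩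
    simpa using hi hj
  refine (Finset.card_le_card hsub).trans ?_
  refine (Finset.card_biUnion_le_card_mul _ _ (2 ^ rowSupport A) fun i _ => ?_).trans ?_
  · rw [Finset.card_powerset]
    exact Nat.pow_le_pow_right (by norm_num) (card_rowVars_le A i)
  · rw [mul_comm]
    refine Nat.mul_le_mul_left _ ?_
    exact Finset.le_sup (f := fun j => (Finset.univ.filter fun i => A i j ≠ 0).card)
      (Finset.mem_univ j)

/-- The weights, with the zero weights replaced by `1`. -/
noncomputable def positiveWeight (w : Fin n → ℝ) (j : Fin n) : ℝ := if w j = 0 then 1 else w j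

theorem positiveWeight_pos (hw : ∀ j, 0 ≤ w j) (j : Fin n) : 0 < positiveWeight w j := by
  unfold positiveWeight
  split_ifs with h
  · exact one_pos
  · exact lt_of_le_of_ne (hw j) (Ne.symm h)

theorem mulVec_eq_sum_rowVars (x : Fin n → ℝ) (i : Fin m) :
    A.mulVec x i = ∑ j ∈ rowVars A i, A i j * x j := by
  rw [Matrix.mulVec, dotProduct, rowVars, Finset.sum_filter_of_ne]
  exact fun j _ h => left_ne_zero_of_mul h

/-- By nonnegativity of `A`, setting all variables outside `e` to `1` can only help. Thus no
solution vanishes on a hyperedge. -/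
theorem IsZeroOneSolution.le_sum_rowVars {y : Fin n → ℝ} (hA : IsCovering A b w)
    (hy : IsZeroOneSolution A b y) {i : Fin m} {e : Finset (Fin n)} (he : ∀ j ∈ e, y j = 0) :
    b i ≤ ∑ j ∈ rowVars A i \ e, A i j := by
  refine (hy.2 i).trans ?_
  rw [mulVec_eq_sum_rowVars, ← Finset.sum_sdiff (Finset.inter_subset_left (s₁ := rowVars A i)
    (s₂ := e)), Finset.sdiff_inter_self_left, Finset.sum_eq_zero (s := rowVars A i ∩ e), add_zero]
  · refine Finset.sum_le_sum fun j _ => mul_le_of_le_one_right (hA.1 i j) ?_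
    rcases hy.1 j with h | h <;> rw [h]
    exact zero_le_one
  · intro j hj
    rw [he j (Finset.mem_inter.1 hj).2, mul_zero]

open Classical in
/-- A cover of the hypergraph, together with the variables of weight zero, is a solution; the
cover computed by Algorithm MWHVC is an approximate one. -/
theorem isApproxSolution_of_cover {f : ℕ} {ε α : ℝ} {N : ℕ} (hA : IsCovering A b w)
    (hy : ∃ y, IsZeroOneSolution A b y) (hf : rowSupport A = f) (hf0 : 0 < f) (hε : 0 < ε)
    (hα : 2 ≤ α) (hN : (coverHypergraph A b w).uncovered (MState.after (coverHypergraph A b w)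
      (positiveWeight w) (ε / (f + ε)) α (1 / 2) N).cover = ∅) :
    IsApproxSolution A b w (f + ε) fun j => if w j = 0 ∨ j ∈ (MState.after (coverHypergraph A b w)
      (positiveWeight w) (ε / (f + ε)) α (1 / 2) N).cover then 1 else 0 := by
  have hratio := fun Y => MState.sum_cover_le (Y := Y) hε
    (hf ▸ coverHypergraph_rankLE (A := A) (b := b) (w := w)) hf0 hα (positiveWeight_pos hA.2.2) N
  set C := (MState.after (coverHypergraph A b w) (positiveWeight w) (ε / (f + ε)) α (1 / 2) N).cover
  refine ⟨⟨fun j => ?_, fun i => ?_⟩, fun y hy => ?_⟩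
  · dsimp only
    split_ifs <;> simp
  · by_contra hlt
    obtain ⟨y, hy⟩ := hy
    -- If the constraint fails, the variables of its row that are set to zero form a hyperedge
    -- disjoint from `C`.
    set e := (rowVars A i).filter fun j => ¬ (w j = 0 ∨ j ∈ C) with he
    have hsum : A.mulVec (fun j => if w j = 0 ∨ j ∈ C then (1 : ℝ) else 0) i
        = ∑ j ∈ rowVars A i \ e, A i j := by
      rw [mulVec_eq_sum_rowVars, he, Finset.filter_not, Finset.sdiff_sdiff_eq_self
        (Finset.filter_subset _ _), Finset.sum_filter]
      exact Finset.sum_congr rfl fun j _ => by split_ifs <;> simp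
    rw [hsum, not_le] at hlt
    -- Feasibility enters here: a constraint violated by the all-ones vector would have no solution.
    have hne : e.Nonempty := by
      rw [Finset.nonempty_iff_ne_empty]
      intro h0
      rw [h0] at hlt
      exact absurd (hy.le_sum_rowVars hA (e := ∅) (i := i) (by simp)) (not_le.2 hlt)
    have hmem : ∀ j ∈ e, w j ≠ 0 ∧ j ∉ C := fun j hj => by
      simpa using not_or.1 (Finset.mem_filter.1 hj).2
    have hunc : e ∈ (coverHypergraph A b w).uncovered C :=
      Hypergraph.mem_uncovered.2 ⟨mem_coverHypergraph.2 ⟨hne, i, Finset.filter_subset _ _,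
        fun j hj => (hmem j hj).1, hlt⟩, Finset.disjoint_left.2 fun j hj => (hmem j hj).2⟩
    rw [hN] at hunc
    exact absurd hunc (Finset.notMem_empty _)
  -- The support of `y` on positive weights is a vertex cover, and its weight is at most that of
  -- `y`.
  · set Y := Finset.univ.filter fun j => y j = 1 ∧ w j ≠ 0 with hYdef
    have hYcover : ∀ e ∈ (coverHypergraph A b w).edges, ∃ v ∈ e, v ∈ Y := by
      intro e he
      obtain ⟨_, i, _, hpos, hlt⟩ := mem_coverHypergraph.1 he
      by_contra hno
      push Not at hno
      refine absurd (hy.le_sum_rowVars hA (e := e) (i := i) fun j hj => ?_) (not_le.2 hlt)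
      refine (hy.1 j).resolve_right fun h1 => hno j hj ?_
      exact Finset.mem_filter.2 ⟨Finset.mem_univ _, h1, hpos j hj⟩
    have h1 : w ⬝ᵥ (fun j => if w j = 0 ∨ j ∈ C then (1 : ℝ) else 0)
        ≤ ∑ j ∈ C, positiveWeight w j := by
      rw [dotProduct, ← Finset.sum_filter_add_sum_filter_not Finset.univ (· ∈ C),
        Finset.sum_eq_zero (s := Finset.univ.filter (· ∉ C)), add_zero, Finset.filter_mem_eq_inter,
        Finset.univ_inter]
      · refine Finset.sum_le_sum fun j hj => ?_
        simp only [hj, or_true, if_true, mul_one, positiveWeight]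
        split_ifs with h0
        · rw [h0]; exact zero_le_one
        · exact le_rfl
      · intro j hj
        have hj' : j ∉ C := (Finset.mem_filter.1 hj).2
        by_cases h0 : w j = 0 <;> simp [h0, hj']
    have h2 : ∑ j ∈ Y, positiveWeight w j ≤ w ⬝ᵥ y := by
      rw [dotProduct, hYdef, Finset.sum_filter]
      refine Finset.sum_le_sum fun j _ => ?_
      have hwj := hA.2.2 j
      split_ifs with h0
      · rw [positiveWeight, if_neg h0.2, h0.1, mul_one]
      · rcases hy.1 j with h | h <;> rw [h] <;> simp [hwj]
    refine h1.trans ((hratio Y hYcover).trans (mul_le_mul_of_nonneg_left h2 (by positivity)))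

/-! ### Locality of the reduction to vertex cover. -/

theorem SameAround.symm {j : Fin n} (h : SameAround A A' b b' w w' j) :
    SameAround A' A b' b w' w j where
  weight := h.weight.symm
  column i := (h.column i).symm
  rhs i hi := (h.rhs i (h.column i ▸ hi)).symm
  row i hi k := (h.row i (h.column i ▸ hi) k).symm
  row_weight i hi k hk := by
    have hi' : A i j ≠ 0 := h.column i ▸ hi
    exact (h.row_weight i hi' k (h.row i hi' k ▸ hk)).symm

/-- A hyperedge at `j` comes from a row containing `j`, and all data of such rows agree. One
inclusion is enough, since the relation is symmetric. -/
theorem SameAround.incident_subset {j : Fin n} (h : SameAround A A' b b' w w' j) :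
    (coverHypergraph A b w).incident j ⊆ (coverHypergraph A' b' w').incident j := by
  intro e he
  obtain ⟨he, hj⟩ := Hypergraph.mem_incident.1 he
  obtain ⟨hne, i, hi, hpos, hlt⟩ := mem_coverHypergraph.1 he
  have hij : A i j ≠ 0 := mem_rowVars.1 (hi hj)
  have hrow := h.row i hij
  have hvars : rowVars A' i = rowVars A i := by ext k; simp [hrow]
  refine Hypergraph.mem_incident.2 ⟨mem_coverHypergraph.2 ⟨hne, i, hvars ▸ hi, fun k hk => ?_, ?_⟩, hj⟩
  · rw [← h.row_weight i hij k (mem_rowVars.1 (hi hk))]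
    exact hpos k hk
  · rw [hvars, ← h.rhs i hij, ← Finset.sum_congr rfl fun k _ => hrow k]
    exact hlt

theorem SameAround.statusNumber_eq {j : Fin n} {β α : ℝ} (hα : 2 ≤ α) (hw : ∀ j, 0 ≤ w j)
    (hw' : ∀ j, 0 ≤ w' j) (h : SameAround A A' b b' w w' j) {p : ℕ}
    (hs : ∀ q < p, ∀ i, A i j ≠ 0 → ∀ k, A i k ≠ 0 →
      statusNumber (coverHypergraph A b w) (positiveWeight w) β α q k
        = statusNumber (coverHypergraph A' b' w') (positiveWeight w') β α q k) :
    statusNumber (coverHypergraph A b w) (positiveWeight w) β α p j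
      = statusNumber (coverHypergraph A' b' w') (positiveWeight w') β α p j := by
  have hrow : ∀ e ∈ (coverHypergraph A b w).incident j, ∀ u ∈ e, ∃ i, A i j ≠ 0 ∧ A i u ≠ 0 := by
    intro e he u hu
    obtain ⟨he, hj⟩ := Hypergraph.mem_incident.1 he
    obtain ⟨_, i, hi, _⟩ := mem_coverHypergraph.1 he
    exact ⟨i, mem_rowVars.1 (hi hj), mem_rowVars.1 (hi hu)⟩
  refine DistCover.statusNumber_eq hα (positiveWeight_pos hw) (positiveWeight_pos hw')
    (h.incident_subset.antisymm h.symm.incident_subset) ?_ ?_ ?_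
  · rw [positiveWeight, positiveWeight, h.weight]
  · intro e he u hu
    obtain ⟨i, hij, hiu⟩ := hrow e he u hu
    rw [positiveWeight, positiveWeight, h.row_weight i hij u hiu]
  · intro q hq e he u hu
    obtain ⟨i, hij, hiu⟩ := hrow e he u hu
    exact hs q hq i hij u hiu

open Classical in
/-- If every constraint has at most one variable, the forced variables form an optimal solution. -/
theorem isApproxSolution_of_rowSupport_le_one {f : ℕ} {ε : ℝ} (hA : IsCovering A b w)
    (hy : ∃ y, IsZeroOneSolution A b y) (hf : rowSupport A = f) (hf1 : f ≤ 1) (hε : 0 < ε) :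
    IsApproxSolution A b w (f + ε) fun j => if ∃ i, A i j ≠ 0 ∧ 0 < b i then 1 else 0 := by
  have hsingle : ∀ i j, A i j ≠ 0 → ∀ x : Fin n → ℝ, A.mulVec x i = A i j * x j := by
    intro i j hij x
    rw [mulVec_eq_sum_rowVars]
    have hc : (rowVars A i).card ≤ 1 := (card_rowVars_le A i).trans (hf ▸ hf1)
    have hj : j ∈ rowVars A i := mem_rowVars.2 hij
    have : rowVars A i = {j} :=
      Finset.eq_singleton_iff_unique_mem.2 ⟨hj, fun k hk => Finset.card_le_one.1 hc k hk j hj⟩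
    rw [this, Finset.sum_singleton]
  refine ⟨⟨fun j => ?_, fun i => ?_⟩, fun y hy => ?_⟩
  · dsimp only
    split_ifs <;> simp
  · obtain ⟨y, hy⟩ := hy
    have hyi := hy.2 i
    rcases le_or_gt (b i) 0 with hb | hb
    · rw [mulVec_eq_sum_rowVars]
      refine hb.trans (Finset.sum_nonneg fun j _ => mul_nonneg (hA.1 i j) ?_)
      split_ifs <;> norm_num
    · have hne : A.mulVec y i ≠ 0 := (hb.trans_le hyi).ne'
      rw [mulVec_eq_sum_rowVars] at hne
      obtain ⟨j, hj, _⟩ := Finset.exists_ne_zero_of_sum_ne_zero hne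
      have hij := mem_rowVars.1 hj
      rw [hsingle i j hij] at hyi ⊢
      rw [if_pos ⟨i, hij, hb⟩, mul_one]
      refine hyi.trans (mul_le_of_le_one_right (hA.1 i j) ?_)
      rcases hy.1 j with h | h <;> rw [h]
      exact zero_le_one
  · rw [dotProduct, dotProduct, Finset.mul_sum]
    refine Finset.sum_le_sum fun j _ => ?_
    have hwj := hA.2.2 j
    have hyj : 0 ≤ y j := by rcases hy.1 j with h | h <;> rw [h]; exact zero_le_one
    split_ifs with h
    · obtain ⟨i, hij, hb⟩ := h
      have hf0 : (1 : ℝ) ≤ f := by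
        rw [← hf]
        exact_mod_cast (Finset.card_pos.2 ⟨j, mem_rowVars.2 hij⟩).trans_le (card_rowVars_le A i)
      have hy1 : y j = 1 := by
        refine (hy.1 j).resolve_left fun h0 => ?_
        have := hy.2 i
        rw [hsingle i j hij, h0, mul_zero] at this
        linarith
      rw [hy1, mul_one]
      nlinarith
    · rw [mul_zero]
      positivity

end Reduction

/-! ## The distributed algorithm for covering programs -/

section Main

/-- The covering programs with given parameters. -/
def CoveringProgram (dec : List Bool → ℝ) (K n m f Δ : ℕ) : Type :=
  {P : Matrix (Fin m) (Fin n) ℝ × (Fin m → ℝ) × (Fin n → ℝ) //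
    IsCovering P.1 P.2.1 P.2.2 ∧ rowSupport P.1 = f ∧ colSupport P.1 = Δ ∧
      InputHasCodes dec K P.1 P.2.1 P.2.2 ∧ ∃ y, IsZeroOneSolution P.1 P.2.1 y}

theorem one_le_bitSize (N : ℕ) : 1 ≤ bitSize N := by simp [bitSize]

theorem lt_two_pow_bitSize (N : ℕ) : N < 2 ^ bitSize N :=
  Nat.lt_pow_succ_log_self (by norm_num) N

theorem colSupport_le {m n : ℕ} (A : Matrix (Fin m) (Fin n) ℝ) : colSupport A ≤ m :=
  Finset.sup_le fun _ _ => (Finset.card_le_univ _).trans_eq (Fintype.card_fin m)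

theorem rowSupport_le {m n : ℕ} (A : Matrix (Fin m) (Fin n) ℝ) : rowSupport A ≤ n :=
  Finset.sup_le fun _ _ => (Finset.card_le_univ _).trans_eq (Fintype.card_fin n)

/-- The slowdown due to messages of `bits` bits. -/
def slowdown (f bits : ℕ) : ℕ := f / bits + 1

theorem lt_mul_slowdown {f bits : ℕ} (hb : 0 < bits) : f < bits * slowdown f bits :=
  Nat.lt_mul_div_succ f hb

/-- Since `log 2 < 1`, the message length `bitSize (n + m)` is at least the natural logarithm of
`n`. -/
theorem slowdown_le {f n m : ℕ} (hn : 2 ≤ n) :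
    (slowdown f (bitSize (n + m)) : ℝ) ≤ 1 + f / Real.log n := by
  have hn' : (2 : ℝ) ≤ n := by exact_mod_cast hn
  have hlog : 0 < Real.log n := Real.log_pos (by linarith)
  have h1 : Real.log n ≤ bitSize (n + m) := by
    have h2 : (n : ℝ) ≤ 2 ^ bitSize (n + m) := by
      exact_mod_cast (Nat.le_add_right n m).trans (lt_two_pow_bitSize (n + m)).le
    have h3 := Real.log_le_log (by linarith) h2
    rw [Real.log_pow] at h3
    have h4 := Real.log_two_lt_d9
    have h5 : (0 : ℝ) ≤ bitSize (n + m) := Nat.cast_nonneg _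
    nlinarith
  have h2 : ((f / bitSize (n + m) : ℕ) : ℝ) ≤ f / bitSize (n + m) := Nat.cast_div_le
  have h3 : (f : ℝ) / bitSize (n + m) ≤ f / Real.log n :=
    div_le_div_of_nonneg_left (Nat.cast_nonneg f) hlog h1
  rw [slowdown]
  push_cast
  linarith

/-- The number of rounds spent on a step. -/
def stepRounds (f bits t : ℕ) : ℕ :=
  -- The first four steps are the report and the answer in the two phases with long reports: input
  -- data and degrees.
  if t < 4 then 2 * slowdown f bits * (1 + f) else slowdown f bits

theorem stepRounds_pos (f bits t : ℕ) : 0 < stepRounds f bits t := by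
  unfold stepRounds slowdown
  split_ifs <;> positivity

theorem sum_stepRounds_le (f bits k : ℕ) : ∑ t ∈ Finset.range (4 + k), stepRounds f bits t
    ≤ slowdown f bits * (8 * (1 + f) + k) := by
  rw [Finset.sum_range_add]
  have h1 : ∑ t ∈ Finset.range 4, stepRounds f bits t = slowdown f bits * (8 * (1 + f)) := by
    simp [Finset.sum_range_succ, stepRounds]
    ring
  have h2 : ∑ t ∈ Finset.range k, stepRounds f bits (4 + t) = slowdown f bits * k := by
    simp [stepRounds, mul_comm]
  rw [h1, h2, ← mul_add]

/-- The length of the status numbers: degrees first, then single bits. -/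
def statusBits (f bits p : ℕ) : ℕ := if p = 0 then f + bits else 1

theorem statusBits_pos (f : ℕ) {s : ℕ} (hs : 0 < s) (p : ℕ) : 0 < statusBits f s p := by
  unfold statusBits
  split_ifs <;> omega

/-- With `1 + f` in place of `f`, one estimate covers both reports and answers. The constant is
reached in phase `0`: an identifier, two numbers of `2 κ s` bits per variable, and the right-hand
side. -/
theorem reportLength_le (κ f : ℕ) {s : ℕ} (hs : 0 < s) (p : ℕ) :
    2 * (κ * s) + (1 + f) * reportLength (κ * s) s (statusBits f s) p
      ≤ (6 * κ + 2) * s * stepRounds f s (2 * p) := by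
  have hg := (lt_mul_slowdown (f := f) hs).le
  have hg1 : 1 ≤ slowdown f s := Nat.succ_le_succ (Nat.zero_le _)
  have hf1 : 1 ≤ 1 + f := by omega
  unfold stepRounds
  obtain rfl | rfl | ⟨q, rfl⟩ : p = 0 ∨ p = 1 ∨ ∃ q, p = q + 2 := by
    rcases p with _ | _ | q <;> simp
  · simp only [reportLength]
    rw [if_pos (by norm_num)]
    calc 2 * (κ * s) + (1 + f) * (s + 4 * (κ * s))
        ≤ 2 * (κ * s) * (1 + f) + (1 + f) * (s + 4 * (κ * s)) :=
          Nat.add_le_add_right (Nat.le_mul_of_pos_right _ hf1) _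
      _ = (6 * κ + 1) * s * (1 + f) := by ring
      _ ≤ (6 * κ + 2) * s * (2 * slowdown f s * (1 + f)) := by
          gcongr
          · norm_num
          · exact Nat.le_mul_of_pos_left _ (by positivity)
  -- Degrees have `f + s` bits, and `f` is at most `s` times the slowdown.
  · simp only [reportLength, statusBits, if_true]
    rw [if_pos (by norm_num)]
    calc 2 * (κ * s) + (1 + f) * (f + s)
        ≤ 2 * (κ * s) * (slowdown f s * (1 + f))
            + (1 + f) * (s * slowdown f s + s * slowdown f s) := by
          refine Nat.add_le_add (Nat.le_mul_of_pos_right _ (Nat.mul_pos hg1 hf1)) ?_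
          exact Nat.mul_le_mul_left _ (Nat.add_le_add hg (Nat.le_mul_of_pos_right _ hg1))
      _ = (κ + 1) * s * (2 * slowdown f s * (1 + f)) := by ring
      _ ≤ (6 * κ + 2) * s * (2 * slowdown f s * (1 + f)) := by
          gcongr
          · omega
          · norm_num
  · simp only [reportLength, statusBits]
    rw [if_neg (by omega), if_neg (by omega), mul_one]
    calc 2 * (κ * s) + (1 + f) ≤ 2 * (κ * s) * slowdown f s + s * slowdown f s := by
          refine Nat.add_le_add (Nat.le_mul_of_pos_right _ hg1) ?_
          rw [add_comm]
          exact lt_mul_slowdown hs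
      _ = (2 * κ + 1) * s * slowdown f s := by ring
      _ ≤ (6 * κ + 2) * s * slowdown f s := by
          gcongr <;> norm_num

theorem stepRounds_odd (f s p : ℕ) : stepRounds f s (2 * p + 1) = stepRounds f s (2 * p) := by
  unfold stepRounds
  by_cases h : 2 * p < 4
  · rw [if_pos h, if_pos (by omega)]
  · rw [if_neg h, if_neg (by omega)]

variable {dec : List Bool → ℝ} {κ n m f Δ : ℕ} {ε : ℝ}

/-- `exists_algorithm_of_broadcast` for covering programs and `k` rounds of broadcasts. -/
theorem exists_algorithm_of_status {k : ℕ}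
    {X : CoveringProgram dec (κ * bitSize (n + m)) n m f Δ → ℕ → Fin n → ℕ}
    {out : CoveringProgram dec (κ * bitSize (n + m)) n m f Δ → Fin n → ℝ}
    (hX : ∀ P p j, X P p j < 2 ^ statusBits f (bitSize (n + m)) p)
    (hloc : ∀ P P' j p, p < k →
      SameAround P.1.1 P'.1.1 P.1.2.1 P'.1.2.1 P.1.2.2 P'.1.2.2 j →
      (∀ q < p, ∀ i, P.1.1 i j ≠ 0 → ∀ u, P.1.1 i u ≠ 0 → X P q u = X P' q u) → X P p j = X P' p j)
    (hout : ∀ P P' j, SameAround P.1.1 P'.1.1 P.1.2.1 P'.1.2.1 P.1.2.2 P'.1.2.2 j →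
      (∀ q < k, ∀ i, P.1.1 i j ≠ 0 → ∀ u, P.1.1 i u ≠ 0 → X P q u = X P' q u) →
      out P j = out P' j) :
    ∃ alg : DistAlgorithm (Fin n ⊕ Fin m) (LocalInput m) ℝ,
      ∀ P : CoveringProgram dec (κ * bitSize (n + m)) n m f Δ,
      alg.MessagesLE (network P.1.1) (localInput P.1.1 P.1.2.1 P.1.2.2)
        ((6 * κ + 2) * bitSize (n + m)) ∧
      alg.HaltsWithin (network P.1.1) (localInput P.1.1 P.1.2.1 P.1.2.2)
        (∑ t ∈ Finset.range (2 * (k + 1)), stepRounds f (bitSize (n + m)) t) ∧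
      ∀ j, alg.output (alg.config (network P.1.1) (localInput P.1.1 P.1.2.1 P.1.2.2)
        (∑ t ∈ Finset.range (2 * (k + 1)), stepRounds f (bitSize (n + m)) t) (Sum.inl j))
          = out P j := by
  have hs : 0 < bitSize (n + m) := one_le_bitSize _
  refine exists_algorithm_of_broadcast (dec := dec) (K := κ * bitSize (n + m))
    (s := bitSize (n + m)) (l := statusBits f (bitSize (n + m)))
    (A := fun P : CoveringProgram dec (κ * bitSize (n + m)) n m f Δ => P.1.1)
    (b := fun P => P.1.2.1) (w := fun P => P.1.2.2) (X := X) (f := f) (T := k) hs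
    ((Nat.le_add_right n m).trans (lt_two_pow_bitSize _).le) (statusBits_pos f hs)
    (fun P => P.2.2.2.2.1) (fun P => P.2.2.1.le) hX (by positivity) (stepRounds_pos f _)
    (fun p _ => ?_) (fun p _ => ?_) hloc hout
  · have := reportLength_le κ f hs p
    nlinarith [Nat.zero_le (f * reportLength (κ * bitSize (n + m)) (bitSize (n + m))
      (statusBits f (bitSize (n + m))) p), Nat.zero_le (κ * bitSize (n + m))]
  · have := reportLength_le κ f hs p
    rw [stepRounds_odd]
    nlinarith [Nat.zero_le (reportLength (κ * bitSize (n + m)) (bitSize (n + m))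
      (statusBits f (bitSize (n + m))) p)]

/-- The algorithm for programs in which every constraint has at most one variable. -/
theorem exists_algorithm_of_rank_le_one (hf : f ≤ 1) (hε : 0 < ε) :
    ∃ alg : DistAlgorithm (Fin n ⊕ Fin m) (LocalInput m) ℝ, ∃ R ≤ 64,
      ∀ P : CoveringProgram dec (κ * bitSize (n + m)) n m f Δ,
      alg.MessagesLE (network P.1.1) (localInput P.1.1 P.1.2.1 P.1.2.2)
        ((6 * κ + 2) * bitSize (n + m)) ∧
      alg.HaltsWithin (network P.1.1) (localInput P.1.1 P.1.2.1 P.1.2.2) R ∧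
      IsApproxSolution P.1.1 P.1.2.1 P.1.2.2 (f + ε) fun j =>
        alg.output (alg.config (network P.1.1) (localInput P.1.1 P.1.2.1 P.1.2.2) R (Sum.inl j)) := by
  classical
  obtain ⟨alg, halg⟩ := exists_algorithm_of_status (dec := dec) (κ := κ) (n := n) (m := m) (f := f)
    (Δ := Δ) (k := 0) (X := fun _ _ _ => 0)
    (out := fun P j => if ∃ i, P.1.1 i j ≠ 0 ∧ 0 < P.1.2.1 i then 1 else 0)
    (fun _ _ _ => by positivity) (fun _ _ _ _ h => absurd h (Nat.not_lt_zero _)) (by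
      intro P P' j h _
      refine if_congr (exists_congr fun i => ?_) rfl rfl
      rw [← h.column i]
      exact and_congr_right fun hij => by rw [h.rhs i hij])
  refine ⟨alg, _, ?_, fun P => ⟨(halg P).1, (halg P).2.1, ?_⟩⟩
  · have h1 := sum_stepRounds_le f (bitSize (n + m)) 0
    have h2 : ∑ t ∈ Finset.range (2 * (0 + 1)), stepRounds f (bitSize (n + m)) t
        ≤ ∑ t ∈ Finset.range (4 + 0), stepRounds f (bitSize (n + m)) t :=
      Finset.sum_le_sum_of_subset (Finset.range_subset_range.2 (by norm_num))
    have h3 : slowdown f (bitSize (n + m)) ≤ 2 := by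
      have := Nat.div_le_self f (bitSize (n + m))
      unfold slowdown
      omega
    nlinarith
  · simp only [(halg P).2.2]
    exact isApproxSolution_of_rowSupport_le_one P.2.1 P.2.2.2.2.2 P.2.2.1 hf hε

/-- The simulation of `N` iterations of Algorithm MWHVC. -/
theorem exists_algorithm_of_iterations (hf : 0 < f) (hε : 0 < ε) {α : ℝ} (hα : 2 ≤ α) {N : ℕ}
    (hN : ∀ (H : Hypergraph (Fin n)) (w : Fin n → ℝ), H.RankLE f → H.DegreeLE (2 ^ f * Δ) →
      (∀ j, 0 < w j) → H.uncovered (MState.after H w (ε / (f + ε)) α (1 / 2) N).cover = ∅) :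
    ∃ alg : DistAlgorithm (Fin n ⊕ Fin m) (LocalInput m) ℝ,
      ∃ R ≤ slowdown f (bitSize (n + m)) * (8 * (1 + f) + 6 * N),
      ∀ P : CoveringProgram dec (κ * bitSize (n + m)) n m f Δ,
      alg.MessagesLE (network P.1.1) (localInput P.1.1 P.1.2.1 P.1.2.2)
        ((6 * κ + 2) * bitSize (n + m)) ∧
      alg.HaltsWithin (network P.1.1) (localInput P.1.1 P.1.2.1 P.1.2.2) R ∧
      IsApproxSolution P.1.1 P.1.2.1 P.1.2.2 (f + ε) fun j =>
        alg.output (alg.config (network P.1.1) (localInput P.1.1 P.1.2.1 P.1.2.2) R (Sum.inl j)) := by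
  classical
  set β := ε / (f + ε) with hβ
  let H : CoveringProgram dec (κ * bitSize (n + m)) n m f Δ → Hypergraph (Fin n) := fun P =>
    coverHypergraph P.1.1 P.1.2.1 P.1.2.2
  have hdeg : ∀ P, (H P).DegreeLE (2 ^ f * Δ) := fun P => by
    have := coverHypergraph_degreeLE (A := P.1.1) (b := P.1.2.1) (w := P.1.2.2)
    rwa [P.2.2.1, P.2.2.2.1] at this
  have hpos : ∀ (P : CoveringProgram dec (κ * bitSize (n + m)) n m f Δ) j,
      0 < positiveWeight P.1.2.2 j := fun P => positiveWeight_pos P.2.1.2.2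
  -- One number for the degree and three for each of the `N` iterations.
  refine Exists.elim (exists_algorithm_of_status (dec := dec) (κ := κ) (n := n) (m := m) (f := f)
    (Δ := Δ) (k := 3 * N + 1)
    (X := fun P p j => statusNumber (H P) (positiveWeight P.1.2.2) β α p j)
    (out := fun P j => if P.1.2.2 j = 0 ∨ j ∈ (MState.after (H P) (positiveWeight P.1.2.2) β α
      (1 / 2) N).cover then 1 else 0) ?_ ?_ ?_) fun alg halg => ?_
  · intro P p j
    by_cases hp : p = 0
    · subst hp
      rw [statusNumber_zero, statusBits, if_pos rfl, pow_add]
      refine (hdeg P j).trans_lt (Nat.mul_lt_mul_of_pos_left ?_ (by positivity))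
      rw [← P.2.2.2.1]
      -- The degree is at most `2 ^ f * Δ` with `Δ ≤ m < 2 ^ bitSize (n + m)`, so it fits into `f +
      -- bitSize (n + m)` bits.
      exact (colSupport_le _).trans_lt ((Nat.le_add_left m n).trans_lt (lt_two_pow_bitSize _))
    · rw [statusBits, if_neg hp, pow_one]
      exact statusNumber_lt_two hα (hpos P) hp
  · intro P P' j p _ h hs
    exact h.statusNumber_eq hα P.2.1.2.2 P'.2.1.2.2 hs
  · intro P P' j h hs
    refine if_congr (or_congr (by rw [h.weight]) ?_) rfl rfl
    have hag : ∀ p < 3 * N + 1, statusNumber (H P) (positiveWeight P.1.2.2) β α p j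
        = statusNumber (H P') (positiveWeight P'.1.2.2) β α p j := fun p hp =>
      h.statusNumber_eq hα P.2.1.2.2 P'.2.1.2.2 fun q hq => hs q (by omega)
    -- The final cover is read off from the cover bit of the last iteration; without iterations it
    -- is empty.
    cases N with
    | zero => simp [MState.after, MState.init]
    | succ N =>
      rw [MState.after_succ, MState.after_succ]
      exact mem_newCover_of_statusNumber_eq (hag (3 * N + 1) (by omega))
  · refine ⟨alg, _, ?_, fun P => ⟨(halg P).1, (halg P).2.1, ?_⟩⟩
    · rw [show 2 * (3 * N + 1 + 1) = 4 + 6 * N by ring]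
      exact sum_stepRounds_le f _ _
    · simp only [(halg P).2.2]
      refine isApproxSolution_of_cover P.2.1 P.2.2.2.2.2 P.2.2.1 hf hε hα (hN (H P) _ ?_ (hdeg P)
        (hpos P))
      have := coverHypergraph_rankLE (A := P.1.1) (b := P.1.2.1) (w := P.1.2.2)
      rwa [P.2.2.1] at this

/-- After `(T - 2) / 4` iterations of Algorithm MWHVC, where `T` is its number of rounds, all
hyperedges are covered. -/
theorem uncovered_eq_empty_of_mwhvcRounds {γ : ℝ} {D T : ℕ} (hT : mwhvcRounds γ f D ε = T)
    {H : Hypergraph (Fin n)} {w : Fin n → ℝ} (hf : H.RankLE f) (hD : H.DegreeLE D)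
    (hw : ∀ j, 0 < w j) : H.uncovered (MState.after H w (ε / (f + ε)) (multiplier γ f D ε) (1 / 2)
      ((T - 2) / 4)).cover = ∅ := by
  have h1 : mwhvcRoundsOn H w (ε / (f + ε)) (multiplier γ f D ε) (1 / 2) ≤ T := by
    rw [← hT]
    exact le_iSup_of_le n (le_iSup_of_le H (le_iSup_of_le w (le_iSup_of_le ⟨hf, hD, hw⟩ le_rfl)))
  -- The strict form lets a terminating iteration `i` be extracted from the infimum; then `2 + 4 i ≤
  -- T`.
  have h2 : mwhvcRoundsOn H w (ε / (f + ε)) (multiplier γ f D ε) (1 / 2) < ((T + 1 : ℕ) : ℕ∞) :=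
    h1.trans_lt (by rw [Nat.cast_lt]; omega)
  simp only [mwhvcRoundsOn, iInf_lt_iff, Nat.cast_lt] at h2
  obtain ⟨i, hi, hlt⟩ := h2
  rw [← Finset.subset_empty, ← hi]
  exact Hypergraph.uncovered_anti (MState.after_cover_mono (by omega))

end Main

end DistCover

open DistCover in
/-- For all constants `κ` (input length) and `γ` there are constants `B` (message length) and `C`
(running time) such that, for every number format and all values of the globally known parameters
`n, m, f, Δ, ε`, some deterministic distributed algorithm computes an `(f + ε)`-approximate
solution of every feasible zero-one covering program with these parameters, in the stated number of
rounds. -/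
theorem mainTheorem8 (κ : ℕ) (γ : ℝ) (hγ : 0 < γ) :
    ∃ B C : ℕ, ∀ (dec : List Bool → ℝ) (n m f Δ : ℕ) (ε : ℝ), 0 < ε → ε ≤ 1 →
      ∃ alg : DistAlgorithm (Fin n ⊕ Fin m) (LocalInput m) ℝ,
        ∀ (A : Matrix (Fin m) (Fin n) ℝ) (b : Fin m → ℝ) (w : Fin n → ℝ),
          IsCovering A b w → rowSupport A = f → colSupport A = Δ →
          InputHasCodes dec (κ * bitSize (n + m)) A b w →
          (∃ y, IsZeroOneSolution A b y) →
          alg.MessagesLE (network A) (localInput A b w) (B * bitSize (n + m)) ∧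
          ∃ R : ℕ,
            alg.HaltsWithin (network A) (localInput A b w) R ∧
            IsApproxSolution A b w (f + ε) (fun j =>
              alg.output (alg.config (network A) (localInput A b w) R (Sum.inl j))) ∧
            (R : ENNReal) ≤ ENNReal.ofReal (C * (1 + f / Real.log n)) *
              (mwhvcRounds γ f (2 ^ f * Δ) ε : ENNReal) ∧
            (3 ≤ 2 ^ f * Δ →
              (R : ℝ) ≤ C * (1 + f / Real.log n) * closedBound γ f (2 ^ f * Δ) ε) := by
  -- `38` relates the simulation to `T`, and `94 + 16 / γ` relates `T` to the closed expression.
  obtain ⟨C, hC⟩ := exists_nat_ge (38 * (94 + 16 / γ))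
  have hγ' : 0 < 16 / γ := by positivity
  have hC64 : (64 : ℝ) ≤ C := by linarith
  refine ⟨6 * κ + 2, C, fun dec n m f Δ ε hε hε1 => ?_⟩
  -- For `n ≤ 1` the logarithm is `0`, and division by zero makes the factor `1`, as the claim
  -- demands.
  have hfactor : 1 ≤ 1 + (f : ℝ) / Real.log n := by
    have := div_nonneg (Nat.cast_nonneg (α := ℝ) f) (Real.log_natCast_nonneg n)
    linarith
  rcases Nat.lt_or_ge f 2 with hf | hf
  · -- at most one variable per constraint
    obtain ⟨alg, R, hR, halg⟩ := exists_algorithm_of_rank_le_one (dec := dec) (κ := κ) (n := n)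
      (m := m) (Δ := Δ) (Nat.le_of_lt_succ hf) hε
    refine ⟨alg, fun A b w h1 h2 h3 h4 h5 => ?_⟩
    obtain ⟨hm, hh, ha⟩ := halg ⟨(A, b, w), h1, h2, h3, h4, h5⟩
    have hRC : (R : ℝ) ≤ C * (1 + f / Real.log n) := by
      have : (R : ℝ) ≤ 64 := by exact_mod_cast hR
      nlinarith
    refine ⟨hm, R, hh, ha, ?_, fun hD => ?_⟩
    · refine le_trans ?_ (le_mul_of_one_le_right' (b := ((mwhvcRounds γ f (2 ^ f * Δ) ε : ℕ∞) : ℝ≥0∞)) ?_)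
      · rw [← ENNReal.ofReal_natCast]
        exact ENNReal.ofReal_le_ofReal hRC
      · have h := two_le_mwhvcRounds γ f (2 ^ f * Δ) ε
        have h' : (1 : ℕ∞) ≤ mwhvcRounds γ f (2 ^ f * Δ) ε := le_trans (by norm_num) h
        exact_mod_cast h'
    -- For `f = 0` the matrix is zero, so `Δ = 0`, against `3 ≤ 2 ^ f * Δ`.
    · have hf1 : f = 1 := by
        rcases Nat.eq_zero_or_pos f with h0 | h0
        · have hΔ : Δ = 0 := by
            rw [← h3, colSupport, ← Nat.bot_eq_zero, Finset.sup_eq_bot_iff]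
            intro j _
            rw [Nat.bot_eq_zero, Finset.card_eq_zero, Finset.filter_eq_empty_iff]
            intro i _ hij
            have := (Finset.card_pos.2 ⟨j, mem_rowVars.2 hij⟩).trans_le (card_rowVars_le A i)
            omega
          rw [hΔ] at hD
          omega
        · omega
      have hcb : 1 ≤ closedBound γ f (2 ^ f * Δ) ε := by
        rw [hf1] at hD ⊢
        exact one_le_closedBound_of_rank_one hD hε hε1
      exact hRC.trans (le_mul_of_one_le_right (by positivity) hcb)
  · by_cases hΔ : Δ = 0
    · -- there is no such program
      refine ⟨⟨Unit, fun _ _ => (), fun _ _ => [], fun _ _ => (), fun _ => true, fun _ => 0⟩,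
        fun A b w _ h2 h3 _ _ => absurd h2 fun h2 => ?_⟩
      have h0 : rowSupport A = 0 := by
        rw [rowSupport, ← Nat.bot_eq_zero, Finset.sup_eq_bot_iff]
        intro i _
        rw [Nat.bot_eq_zero, Finset.card_eq_zero, Finset.filter_eq_empty_iff]
        intro j _ hij
        have h4 : (Finset.univ.filter fun i => A i j ≠ 0).card ≤ colSupport A :=
          Finset.le_sup (f := fun j => (Finset.univ.filter fun i => A i j ≠ 0).card)
            (Finset.mem_univ j)
        have h5 : 0 < (Finset.univ.filter fun i => A i j ≠ 0).card :=
          Finset.card_pos.2 ⟨i, by simpa using hij⟩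
        omega
      omega
    have hD : 2 ^ f ≤ 2 ^ f * Δ := Nat.le_mul_of_pos_right _ (Nat.pos_of_ne_zero hΔ)
    have hD4 : 4 ≤ 2 ^ f * Δ := (Nat.pow_le_pow_right (by norm_num : 0 < 2) hf).trans hD
    obtain ⟨T, hT, hTcb⟩ := exists_mwhvcRounds_eq hγ hf hD4 hε hε1
    have hfT := rank_le_mwhvcRounds hf hD4 hD hε hε1 hT
    have hT2 := two_le_mwhvcRounds γ f (2 ^ f * Δ) ε
    rw [hT] at hT2
    have hT2' : 2 ≤ T := by exact_mod_cast hT2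
    obtain ⟨alg, R, hR, halg⟩ := exists_algorithm_of_iterations (dec := dec) (κ := κ) (n := n)
      (m := m) (f := f) (Δ := Δ) (by omega) hε (two_le_multiplier γ f (2 ^ f * Δ) ε)
      fun H w h1 h2 h3 => uncovered_eq_empty_of_mwhvcRounds hT h1 h2 h3
    refine ⟨alg, fun A b w h1 h2 h3 h4 h5 => ?_⟩
    obtain ⟨hm, hh, ha⟩ := halg ⟨(A, b, w), h1, h2, h3, h4, h5⟩
    have hn : 2 ≤ n := hf.trans (h2 ▸ rowSupport_le A)
    have hslow := slowdown_le (f := f) (m := m) hn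
    -- With `N = (T - 2) / 4`, `f ≤ 4 T` and `T ≥ 2`, the quantity `8 (1 + f) + 6 N` is at most `38
    -- T`.
    have hRT : R ≤ slowdown f (bitSize (n + m)) * (38 * T) :=
      hR.trans (Nat.mul_le_mul_left _ (by omega))
    have hRT' : (R : ℝ) ≤ 38 * (1 + f / Real.log n) * T := by
      have h6 : (R : ℝ) ≤ slowdown f (bitSize (n + m)) * (38 * T) := by exact_mod_cast hRT
      refine h6.trans ((mul_le_mul_of_nonneg_right hslow (by positivity)).trans_eq ?_)
      ring
    refine ⟨hm, R, hh, ha, ?_, fun _ => ?_⟩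
    · rw [hT]
      have h7 : (((T : ℕ∞) : ℝ≥0∞)) = ENNReal.ofReal T := by
        rw [ENNReal.ofReal_natCast]
        rfl
      rw [h7, ← ENNReal.ofReal_mul (by positivity), ← ENNReal.ofReal_natCast R]
      refine ENNReal.ofReal_le_ofReal (hRT'.trans ?_)
      gcongr
      linarith
    · have h8 := mul_le_mul_of_nonneg_left hTcb
        (show 0 ≤ 38 * (1 + (f : ℝ) / Real.log n) by positivity)
      have hcb := one_le_closedBound (γ := γ) hf hD4 hε hε1
      refine hRT'.trans (h8.trans ?_)
      rw [← mul_assoc]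
      refine mul_le_mul_of_nonneg_right ?_ (by linarith)
      rw [mul_right_comm]
      exact mul_le_mul_of_nonneg_right hC (by linarith)
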